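/- Fix integers $T,n,m\ge 0$, risk-free rates $s_t>1$, and independent $\mathbb{R}^n$-valued random vectors $\mathbf e_t$ ($t=0,\dots,T-1$) on a probability space, each square integrable, absolutely continuous (having a density), and with positive definite covariance matrix. Let $\mathbf P_t=\mathbf e_t-s_t\mathbf 1$ and $\rho_t=\prod_{j=t}^{T-1}s_j$ (so $\rho_T=1$). Fix a target $W\in\mathbb{R}$, coefficients $\gamma_t^\pm\in\mathbb{R}$, matrices $A_t\in\mathbb{R}^{m\times n}$, the cones $\mathcal{A}_t=\{u\in\mathbb{R}^n: A_tu\ge 0\}$, and the risk aversion $$\gamma_t(x)=\gamma_t^+(x-\rho_t^{-1}W)\ \text{ if } x\ge\rho_t^{-1}W,\qquad \gamma_t(x)=-\gamma_t^-(x-\rho_t^{-1}W)\ \text{ if } x<\rho_t^{-1}W .$$ An admissible policy for an initial wealth $X_0\in\mathbb{R}$ consists of measurable maps $u_t:\mathbb{R}\to\mathcal{A}_t$, $0\le t<T$, such that each $\mathbf u_t=u_t(X_t)$ is square integrable along $X_{t+1}=s_tX_t+\mathbf P_t'\mathbf u_t$. A policy $\pi$, given by measurable maps $\pi_t:\mathbb{R}\to\mathcal{A}_t$,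 is a time-consistent policy of the cone-constrained nested mean-variance problem if it is admissible for every $X_0$ and if, for every $t<T$, every $X_0\in\mathbb{R}$ and every policy $u$ admissible for $X_0$ with $u_j=\pi_j$ for all $t<j<T$, replacing $u_t$ by $\pi_t$ in $u$ gives an admissible policy whose objective $$\mathrm{Var}(X_T\mid X_t)-\gamma_t(X_t)\,\mathbb{E}[X_T\mid X_t]$$ is almost surely at most that of $u$. For parameters $a_{t+1}^\pm,b_{t+1}^\pm$ and $K\in\mathbb{R}^n$ put $R=s_t+\mathbf P_t'K$, $\mu=s_t+\mathbb{E}[\mathbf P_t]'K$, $$\alpha^+(K)=\mathbb{E}[a_{t+1}^+R1_{\{R\ge0\}}+a_{t+1}^-R1_{\{R<0\}}],\qquad \alpha^-(K)=\mathbb{E}[a_{t+1}^+R1_{\{R\le0\}}+a_{t+1}^-R1_{\{R>0\}}],$$ and $$F_t^+(K)=\rho_{t+1}^2K'\mathrm{Cov}(\mathbf P_t)K+\mathbb{E}[(2\rho_{t+1}a_{t+1}^++b_{t+1}^+)R^21_{\{R\ge0\}}+(2\rho_{t+1}a_{t+1}^-+b_{t+1}^-)R^21_{\{R<0\}}]-\alpha^+(K)^2-2\rho_{t+1}\alpha^+(K)\mu-\gamma_t^+\alpha^+(K)-\rho_{t+1}\gamma_t^+\mu,$$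 $$F_t^-(K)=\rho_{t+1}^2K'\mathrm{Cov}(\mathbf P_t)K+\mathbb{E}[(2\rho_{t+1}a_{t+1}^++b_{t+1}^+)R^21_{\{R\le0\}}+(2\rho_{t+1}a_{t+1}^-+b_{t+1}^-)R^21_{\{R>0\}}]-\alpha^-(K)^2-2\rho_{t+1}\alpha^-(K)\mu+\gamma_t^-\alpha^-(K)+\rho_{t+1}\gamma_t^-\mu .$$ Consider the backward scheme that starts from $a_T^\pm=b_T^\pm=0$, chooses for $t=T-1,\dots,0$ $$\widetilde K_t^+\in\arg\min_{K\in\mathcal{A}_t}F_t^+(K),\qquad \widetilde K_t^-\in\arg\min_{K\in-\mathcal{A}_t}F_t^-(K),$$ and sets $a_t^\pm=\rho_{t+1}\mathbb{E}[\mathbf P_t]'\widetilde K_t^\pm+\alpha^\pm(\widetilde K_t^\pm)$ and, with $R=s_t+\mathbf P_t'\widetilde K_t^\pm$, $$b_t^+=\rho_{t+1}^2(\widetilde K_t^+)'\mathbb{E}[\mathbf P_t\mathbf P_t']\widetilde K_t^++2\rho_{t+1}\mathbb{E}[(a_{t+1}^+1_{\{R\ge0\}}+a_{t+1}^-1_{\{R<0\}})R\,\mathbf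 P_t'\widetilde K_t^+]+\mathbb{E}[(b_{t+1}^+1_{\{R\ge0\}}+b_{t+1}^-1_{\{R<0\}})R^2],$$ $$b_t^-=\rho_{t+1}^2(\widetilde K_t^-)'\mathbb{E}[\mathbf P_t\mathbf P_t']\widetilde K_t^-+2\rho_{t+1}\mathbb{E}[(a_{t+1}^+1_{\{R\le0\}}+a_{t+1}^-1_{\{R>0\}})R\,\mathbf P_t'\widetilde K_t^-]+\mathbb{E}[(b_{t+1}^+1_{\{R\le0\}}+b_{t+1}^-1_{\{R>0\}})R^2].$$ Then: (i) at every stage, whatever minimizers were chosen at the later times, both minima are attained; so the scheme can be carried out. (ii) For every outcome of the scheme, the policy $$\mathbf u_t^{TC}=\widetilde K_t^+(X_t-\rho_t^{-1}W)1_{\{X_t\ge\rho_t^{-1}W\}}+\widetilde K_t^-(X_t-\rho_t^{-1}W)1_{\{X_t<\rho_t^{-1}W\}},\qquad t=0,\dots,T-1,$$ is time consistent. (iii) If all the minimizers in the scheme are unique, it is the only time-consistent policy. -/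

import Mathlib

open MeasureTheory ProbabilityTheory
open scoped Matrix Pointwise

noncomputable section

/-- The data of a `T`-period market with one risk-free asset (deterministic rate `s t` in period
`t`) and `n` risky assets (random rates `e t`), of an investor with investment target `W` and risk
aversion coefficients `γp t`, `γm t`, and of the constraint matrices `A t`.
Only the periods `t < T` matter. -/
structure ConeMarket (Ω : Type*) (n m : ℕ) where
  T : ℕ
  s : ℕ → ℝ
  e : ℕ → Ω → (Fin n → ℝ)
  W : ℝ
  γp : ℕ → ℝ
  γm : ℕ → ℝ
  A : ℕ → Matrix (Fin m) (Fin n) ℝ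

/-- A pair of sequences of investment funds, used above (`p`) and below (`m`) the discounted
target. -/
structure Funds (n : ℕ) where
  p : ℕ → (Fin n → ℝ)
  m : ℕ → (Fin n → ℝ)

/-- The four parameters `a⁺, a⁻, b⁺, b⁻` at one date. -/
structure FundParams where
  ap : ℝ
  am : ℝ
  bp : ℝ
  bm : ℝ

namespace ConeMarket

variable {Ω : Type*} {n m : ℕ}

/-- Vector of excess rates of return `P_t = e_t - s_t 1`. -/
def P (M : ConeMarket Ω n m) (t : ℕ) (ω : Ω) : Fin n → ℝ := fun i => M.e t ω i - M.s t

/-- `ρ_t = ∏_{j=t}^{T-1} s_j`, so that `ρ_T = 1`. -/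
def ρ (M : ConeMarket Ω n m) (t : ℕ) : ℝ := ∏ j ∈ Finset.Ico t M.T, M.s j

/-- The polyhedral cone `{u | A_t u ≥ 0}`. -/
def cone (M : ConeMarket Ω n m) (t : ℕ) : Set (Fin n → ℝ) := {u | ∀ i, 0 ≤ (M.A t *ᵥ u) i}

/-- The behavioral risk aversion `γ_t(x)`. -/
def riskAversion (M : ConeMarket Ω n m) (t : ℕ) (x : ℝ) : ℝ :=
  if (M.ρ t)⁻¹ * M.W ≤ x then M.γp t * (x - (M.ρ t)⁻¹ * M.W)
  else -M.γm t * (x - (M.ρ t)⁻¹ * M.W)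

/-- The wealth process started at `x0` under the Markov (feedback) policy `u`, which at time `t`
invests the amounts `u t x` in the risky assets when the current wealth is `x`. -/
def wealth (M : ConeMarket Ω n m) (x0 : ℝ) (u : ℕ → ℝ → (Fin n → ℝ)) : ℕ → Ω → ℝ
  | 0 => fun _ => x0
  | t + 1 => fun ω => M.s t * M.wealth x0 u t ω + M.P t ω ⬝ᵥ u t (M.wealth x0 u t ω)

/-- The piecewise linear feedback policy with funds `K`. -/
def feedback (M : ConeMarket Ω n m) (K : Funds n) (t : ℕ) (x : ℝ) : Fin n → ℝ :=
  if (M.ρ t)⁻¹ * M.W ≤ x then (x - (M.ρ t)⁻¹ * M.W) • K.p t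
  else (x - (M.ρ t)⁻¹ * M.W) • K.m t

variable [MeasurableSpace Ω]

/-- Admissible policies for the initial wealth `x0`: Markov controls with realizations in the
cones, square integrable so that conditional mean and variance of terminal wealth make sense. -/
def Admissible (M : ConeMarket Ω n m) (μ : Measure Ω) (x0 : ℝ) (u : ℕ → ℝ → (Fin n → ℝ)) : Prop :=
  ∀ t < M.T, Measurable (u t) ∧ (∀ x, u t x ∈ M.cone t) ∧
    MemLp (fun ω => u t (M.wealth x0 u t ω)) 2 μ

/-- The objective `Var(X_T | X_t) - γ_t(X_t) E[X_T | X_t]` along the policy `u` from `x0`. -/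
def objective (M : ConeMarket Ω n m) (μ : Measure Ω) (x0 : ℝ) (u : ℕ → ℝ → (Fin n → ℝ)) (t : ℕ) :
    Ω → ℝ := fun ω =>
  condVar (MeasurableSpace.comap (M.wealth x0 u t) (borel ℝ)) (M.wealth x0 u M.T) μ ω -
    M.riskAversion t (M.wealth x0 u t ω) *
      condExp (MeasurableSpace.comap (M.wealth x0 u t) (borel ℝ)) μ (M.wealth x0 u M.T) ω

/-- `π` solves the cone-constrained nested mean-variance problem: at every time `t`, whatever the
initial wealth and the admissible decisions taken before `t`, and given that `π` is followed
after `t`, the decision `π t` is feasible and minimizes the time-`t` objective among all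
admissible decisions at time `t`. (The policy `u` below carries the past decisions and the
competing decision at time `t`; replacing its time-`t` decision by `π t` does not change the
wealth at time `t`.) -/
def IsTimeConsistent (M : ConeMarket Ω n m) (μ : Measure Ω) (π : ℕ → ℝ → (Fin n → ℝ)) : Prop :=
  (∀ x0, M.Admissible μ x0 π) ∧
  ∀ t < M.T, ∀ (x0 : ℝ) (u : ℕ → ℝ → (Fin n → ℝ)), M.Admissible μ x0 u →
    (∀ j, t < j → j < M.T → u j = π j) →
      M.Admissible μ x0 (Function.update u t (π t)) ∧
      M.objective μ x0 (Function.update u t (π t)) t ≤ᵐ[μ] M.objective μ x0 u t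

/-- `E[P_t]`. -/
def meanP (M : ConeMarket Ω n m) (μ : Measure Ω) (t : ℕ) : Fin n → ℝ :=
  fun i => ∫ ω, M.P t ω i ∂μ

/-- `E[P_t P_t']`. -/
def momentP (M : ConeMarket Ω n m) (μ : Measure Ω) (t : ℕ) : Matrix (Fin n) (Fin n) ℝ :=
  Matrix.of fun i j => ∫ ω, M.P t ω i * M.P t ω j ∂μ

/-- `s_t + P_t' K`. -/
def R (M : ConeMarket Ω n m) (t : ℕ) (K : Fin n → ℝ) (ω : Ω) : ℝ := M.s t + M.P t ω ⬝ᵥ K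

/-- The function `F_t^+`, with `q` the parameters at time `t + 1`. -/
def Fp (M : ConeMarket Ω n m) (μ : Measure Ω) (t : ℕ) (q : FundParams) (K : Fin n → ℝ) : ℝ :=
  M.ρ (t + 1) ^ 2 *
      (K ⬝ᵥ ((M.momentP μ t - Matrix.vecMulVec (M.meanP μ t) (M.meanP μ t)) *ᵥ K))
  + (∫ ω, (if 0 ≤ M.R t K ω then (2 * M.ρ (t + 1) * q.ap + q.bp) * M.R t K ω ^ 2 else 0) ∂μ)
  + (∫ ω, (if M.R t K ω < 0 then (2 * M.ρ (t + 1) * q.am + q.bm) * M.R t K ω ^ 2 else 0) ∂μ)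
  - ((∫ ω, (if 0 ≤ M.R t K ω then q.ap * M.R t K ω else 0) ∂μ)
      + (∫ ω, (if M.R t K ω < 0 then q.am * M.R t K ω else 0) ∂μ)) ^ 2
  - 2 * M.ρ (t + 1) * (∫ ω, (if 0 ≤ M.R t K ω then q.ap * M.R t K ω else 0) ∂μ)
      * (M.s t + M.meanP μ t ⬝ᵥ K)
  - 2 * M.ρ (t + 1) * (∫ ω, (if M.R t K ω < 0 then q.am * M.R t K ω else 0) ∂μ)
      * (M.s t + M.meanP μ t ⬝ᵥ K)
  - M.γp t * ((∫ ω, (if 0 ≤ M.R t K ω then q.ap * M.R t K ω else 0) ∂μ)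
      + (∫ ω, (if M.R t K ω < 0 then q.am * M.R t K ω else 0) ∂μ))
  - M.ρ (t + 1) * M.γp t * (M.s t + M.meanP μ t ⬝ᵥ K)

/-- The function `F_t^-`, with `q` the parameters at time `t + 1`. -/
def Fm (M : ConeMarket Ω n m) (μ : Measure Ω) (t : ℕ) (q : FundParams) (K : Fin n → ℝ) : ℝ :=
  M.ρ (t + 1) ^ 2 *
      (K ⬝ᵥ ((M.momentP μ t - Matrix.vecMulVec (M.meanP μ t) (M.meanP μ t)) *ᵥ K))
  + (∫ ω, (if M.R t K ω ≤ 0 then (2 * M.ρ (t + 1) * q.ap + q.bp) * M.R t K ω ^ 2 else 0) ∂μ)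
  + (∫ ω, (if 0 < M.R t K ω then (2 * M.ρ (t + 1) * q.am + q.bm) * M.R t K ω ^ 2 else 0) ∂μ)
  - ((∫ ω, (if M.R t K ω ≤ 0 then q.ap * M.R t K ω else 0) ∂μ)
      + (∫ ω, (if 0 < M.R t K ω then q.am * M.R t K ω else 0) ∂μ)) ^ 2
  - 2 * M.ρ (t + 1) * (∫ ω, (if M.R t K ω ≤ 0 then q.ap * M.R t K ω else 0) ∂μ)
      * (M.s t + M.meanP μ t ⬝ᵥ K)
  - 2 * M.ρ (t + 1) * (∫ ω, (if 0 < M.R t K ω then q.am * M.R t K ω else 0) ∂μ)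
      * (M.s t + M.meanP μ t ⬝ᵥ K)
  + M.γm t * ((∫ ω, (if M.R t K ω ≤ 0 then q.ap * M.R t K ω else 0) ∂μ)
      + (∫ ω, (if 0 < M.R t K ω then q.am * M.R t K ω else 0) ∂μ))
  + M.ρ (t + 1) * M.γm t * (M.s t + M.meanP μ t ⬝ᵥ K)

/-- One step of the backward recursion: the parameters at time `t` from the parameters `q` at time
`t + 1` and the funds `Kp`, `Km` used at time `t`. -/
def step (M : ConeMarket Ω n m) (μ : Measure Ω) (t : ℕ) (Kp Km : Fin n → ℝ) (q : FundParams) :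
    FundParams where
  ap := M.ρ (t + 1) * (M.meanP μ t ⬝ᵥ Kp)
    + (∫ ω, (if 0 ≤ M.R t Kp ω then q.ap * M.R t Kp ω else 0) ∂μ)
    + (∫ ω, (if M.R t Kp ω < 0 then q.am * M.R t Kp ω else 0) ∂μ)
  am := M.ρ (t + 1) * (M.meanP μ t ⬝ᵥ Km)
    + (∫ ω, (if M.R t Km ω ≤ 0 then q.ap * M.R t Km ω else 0) ∂μ)
    + (∫ ω, (if 0 < M.R t Km ω then q.am * M.R t Km ω else 0) ∂μ)
  bp := M.ρ (t + 1) ^ 2 * (Kp ⬝ᵥ (M.momentP μ t *ᵥ Kp))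
    + 2 * M.ρ (t + 1) *
      (∫ ω, (if 0 ≤ M.R t Kp ω then q.ap * M.R t Kp ω * (M.P t ω ⬝ᵥ Kp) else 0) ∂μ)
    + 2 * M.ρ (t + 1) *
      (∫ ω, (if M.R t Kp ω < 0 then q.am * M.R t Kp ω * (M.P t ω ⬝ᵥ Kp) else 0) ∂μ)
    + (∫ ω, (if 0 ≤ M.R t Kp ω then q.bp * M.R t Kp ω ^ 2 else 0) ∂μ)
    + (∫ ω, (if M.R t Kp ω < 0 then q.bm * M.R t Kp ω ^ 2 else 0) ∂μ)
  bm := M.ρ (t + 1) ^ 2 * (Km ⬝ᵥ (M.momentP μ t *ᵥ Km))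
    + 2 * M.ρ (t + 1) *
      (∫ ω, (if M.R t Km ω ≤ 0 then q.ap * M.R t Km ω * (M.P t ω ⬝ᵥ Km) else 0) ∂μ)
    + 2 * M.ρ (t + 1) *
      (∫ ω, (if 0 < M.R t Km ω then q.am * M.R t Km ω * (M.P t ω ⬝ᵥ Km) else 0) ∂μ)
    + (∫ ω, (if M.R t Km ω ≤ 0 then q.bp * M.R t Km ω ^ 2 else 0) ∂μ)
    + (∫ ω, (if 0 < M.R t Km ω then q.bm * M.R t Km ω ^ 2 else 0) ∂μ)

/-- The parameters `a_t^±, b_t^±` generated backwards from `a_T^± = b_T^± = 0` by the funds `K`.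
The value at time `t` depends on the funds at the times `t, …, T - 1` only. -/
def params (M : ConeMarket Ω n m) (μ : Measure Ω) (K : Funds n) (t : ℕ) : FundParams :=
  if t < M.T then M.step μ t (K.p t) (K.m t) (M.params μ K (t + 1)) else ⟨0, 0, 0, 0⟩
termination_by M.T - t

/-- `k` belongs to `argmin_{K ∈ 𝒜_t} F_t^+(K)`, with `q` the parameters at time `t + 1`. -/
def IsArgminPlus (M : ConeMarket Ω n m) (μ : Measure Ω) (t : ℕ) (q : FundParams)
    (k : Fin n → ℝ) : Prop :=
  k ∈ M.cone t ∧ IsMinOn (M.Fp μ t q) (M.cone t) k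

/-- `k` belongs to `argmin_{K ∈ -𝒜_t} F_t^-(K)`, with `q` the parameters at time `t + 1`. -/
def IsArgminMinus (M : ConeMarket Ω n m) (μ : Measure Ω) (t : ℕ) (q : FundParams)
    (k : Fin n → ℝ) : Prop :=
  k ∈ -M.cone t ∧ IsMinOn (M.Fm μ t q) (-M.cone t) k

/-- The funds `K` are optimal at all times `t` with `r ≤ t < T`, where the parameters in `F_t^±`
are those generated by `K` itself. -/
def OptimalFrom (M : ConeMarket Ω n m) (μ : Measure Ω) (r : ℕ) (K : Funds n) : Prop :=
  ∀ t, r ≤ t → t < M.T →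
    M.IsArgminPlus μ t (M.params μ K (t + 1)) (K.p t) ∧
    M.IsArgminMinus μ t (M.params μ K (t + 1)) (K.m t)

end ConeMarket

end

/-! Measure wealth by its surplus over `ρ_t⁻¹ W`. The surplus satisfies `Z_{t+1} = s_t Z_t + P_t'
u_t`, and `X_T = Z_T + W`. If piecewise linear feedback is followed from `t + 1` on, the conditional
mean and second moment of `Z_T` given `Z_{t+1} = z` are linear and quadratic in `z` on each
half-line (`meanFn`, `sqFn`). Since `P_t` is independent of the past, the objective at time `t` is,
up to a term free of the decision, the deterministic function `nextCost` of the current surplus `c`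
and the amounts `v` (`objective_eq`).

The risk aversion is proportional to `|c|`, so this cost is positively homogeneous of degree two in
`(c, v)`. Dividing by `|c|` reduces it to `F⁺` if `c > 0` and to `F⁻` if `c < 0` (`Fp_eq_nextCost`,
`Fm_eq_nextCost`). At `c = 0` only a variance remains, and it is minimal exactly at `v = 0` because
the returns have a density. Hence minimizers of `F^±` give optimal feedback, which reproduces the
form of the moments one step earlier.

Attainment is coercivity. After rescaling, a large `v` becomes a unit vector with surplus and risk
aversion near zero, where the cost is close to a variance bounded below on the sphere
(`exists_isMinOn_nextCost`). The variance is positive because the invariant `Regular` holds for the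
parameters of any funds.

For uniqueness, every wealth `x` at time `t` is reached surely by investing nothing risky before
`t`. The almost sure comparison thus becomes a comparison at `x`, and backward induction applies. -/

noncomputable section

/-! ### Piecewise linear and quadratic moment functions. -/

namespace FundParams

/-- Conditional mean of the terminal surplus given that the surplus is `z`, when `r` is the
accumulation factor. -/
def meanFn (q : FundParams) (r z : ℝ) : ℝ :=
  if 0 ≤ z then (r + q.ap) * z else (r + q.am) * z

/-- Conditional second moment of the terminal surplus given that the surplus is `z`. -/
def sqFn (q : FundParams) (r z : ℝ) : ℝ :=
  if 0 ≤ z then (r ^ 2 + 2 * r * q.ap + q.bp) * z ^ 2 else (r ^ 2 + 2 * r * q.am + q.bm) * z ^ 2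

/-- The second moments are positive and dominate the squared means. -/
structure Regular (q : FundParams) (r : ℝ) : Prop where
  pos_p : 0 < r ^ 2 + 2 * r * q.ap + q.bp
  pos_m : 0 < r ^ 2 + 2 * r * q.am + q.bm
  le_p : (r + q.ap) ^ 2 ≤ r ^ 2 + 2 * r * q.ap + q.bp
  le_m : (r + q.am) ^ 2 ≤ r ^ 2 + 2 * r * q.am + q.bm

variable (q : FundParams) (r : ℝ)

lemma meanFn_eq (z : ℝ) : q.meanFn r z = (r + q.ap) * max z 0 + (r + q.am) * min z 0 := by
  unfold meanFn
  split_ifs with h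
  · simp [h]
  · simp [(not_le.1 h).le]

lemma sqFn_eq (z : ℝ) : q.sqFn r z =
    (r ^ 2 + 2 * r * q.ap + q.bp) * max z 0 ^ 2 + (r ^ 2 + 2 * r * q.am + q.bm) * min z 0 ^ 2 := by
  unfold sqFn
  split_ifs with h
  · simp [h]
  · simp [(not_le.1 h).le]

lemma continuous_meanFn : Continuous (q.meanFn r) := by
  simp only [funext (q.meanFn_eq r)]
  fun_prop

lemma continuous_sqFn : Continuous (q.sqFn r) := by
  simp only [funext (q.sqFn_eq r)]
  fun_prop

lemma abs_meanFn_le (z : ℝ) : |q.meanFn r z| ≤ (|r + q.ap| + |r + q.am|) * |z| := by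
  unfold meanFn
  split_ifs
  · rw [abs_mul]
    gcongr
    linarith [abs_nonneg (r + q.am)]
  · rw [abs_mul]
    gcongr
    linarith [abs_nonneg (r + q.ap)]

lemma abs_sqFn_le (z : ℝ) : |q.sqFn r z| ≤
    (|r ^ 2 + 2 * r * q.ap + q.bp| + |r ^ 2 + 2 * r * q.am + q.bm|) * |z| ^ 2 := by
  unfold sqFn
  split_ifs
  · rw [abs_mul, abs_pow]
    gcongr
    linarith [abs_nonneg (r ^ 2 + 2 * r * q.am + q.bm)]
  · rw [abs_mul, abs_pow]
    gcongr
    linarith [abs_nonneg (r ^ 2 + 2 * r * q.ap + q.bp)]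

lemma meanFn_mul {l : ℝ} (hl : 0 ≤ l) (z : ℝ) : q.meanFn r (l * z) = l * q.meanFn r z := by
  rw [meanFn_eq, meanFn_eq, ← mul_zero l, ← mul_max_of_nonneg _ _ hl, ← mul_min_of_nonneg _ _ hl,
    mul_zero]
  ring

lemma sqFn_mul {l : ℝ} (hl : 0 ≤ l) (z : ℝ) : q.sqFn r (l * z) = l ^ 2 * q.sqFn r z := by
  rw [sqFn_eq, sqFn_eq, ← mul_zero l, ← mul_max_of_nonneg _ _ hl, ← mul_min_of_nonneg _ _ hl,
    mul_zero]
  ring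

variable {q r}

lemma Regular.sqFn_nonneg (h : q.Regular r) (z : ℝ) : 0 ≤ q.sqFn r z := by
  unfold sqFn
  split_ifs
  · exact mul_nonneg h.pos_p.le (sq_nonneg _)
  · exact mul_nonneg h.pos_m.le (sq_nonneg _)

lemma Regular.sqFn_pos (h : q.Regular r) {z : ℝ} (hz : z ≠ 0) : 0 < q.sqFn r z := by
  have := h.pos_p
  have := h.pos_m
  unfold sqFn
  split_ifs <;> positivity

lemma Regular.meanFn_sq_le (h : q.Regular r) (z : ℝ) : q.meanFn r z ^ 2 ≤ q.sqFn r z := by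
  unfold meanFn sqFn
  split_ifs
  · rw [mul_pow]
    exact mul_le_mul_of_nonneg_right h.le_p (sq_nonneg _)
  · rw [mul_pow]
    exact mul_le_mul_of_nonneg_right h.le_m (sq_nonneg _)

variable {Ω : Type*} [MeasurableSpace Ω] {μ : Measure Ω} [IsProbabilityMeasure μ] {Z : Ω → ℝ}

omit [IsProbabilityMeasure μ] in
variable (q r) in
lemma memLp_meanFn (hZ : MemLp Z 2 μ) : MemLp (fun ω => q.meanFn r (Z ω)) 2 μ :=
  (hZ.abs.const_mul (|r + q.ap| + |r + q.am|)).mono'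
    ((q.continuous_meanFn r).comp_aestronglyMeasurable hZ.1)
    (.of_forall fun _ => q.abs_meanFn_le r _)

omit [IsProbabilityMeasure μ] in
variable (q r) in
lemma integrable_sqFn (hZ : MemLp Z 2 μ) : Integrable (fun ω => q.sqFn r (Z ω)) μ :=
  (hZ.abs.integrable_sq.const_mul
      (|r ^ 2 + 2 * r * q.ap + q.bp| + |r ^ 2 + 2 * r * q.am + q.bm|)).mono'
    ((q.continuous_sqFn r).comp_aestronglyMeasurable hZ.1)
    (.of_forall fun _ => q.abs_sqFn_le r _)

lemma sq_integral_le_integral_sq (hZ : MemLp Z 2 μ) : (∫ ω, Z ω ∂μ) ^ 2 ≤ ∫ ω, Z ω ^ 2 ∂μ := by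
  have h := variance_nonneg Z μ
  rw [variance_eq_sub hZ] at h
  simpa using h

/-- Jensen's inequality combined with the pointwise bound; this is what lets `Regular` pass from one
date to the previous one. -/
lemma Regular.sq_integral_meanFn_le (h : q.Regular r) (hZ : MemLp Z 2 μ) :
    (∫ ω, q.meanFn r (Z ω) ∂μ) ^ 2 ≤ ∫ ω, q.sqFn r (Z ω) ∂μ :=
  (sq_integral_le_integral_sq (q.memLp_meanFn r hZ)).trans
    (integral_mono (q.memLp_meanFn r hZ).integrable_sq (q.integrable_sqFn r hZ)
      fun _ => h.meanFn_sq_le _)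

lemma Regular.integral_sqFn_pos (h : q.Regular r) (hZ : MemLp Z 2 μ) (h0 : ∀ᵐ ω ∂μ, Z ω ≠ 0) :
    0 < ∫ ω, q.sqFn r (Z ω) ∂μ := by
  refine (integral_nonneg fun _ => h.sqFn_nonneg _).lt_of_ne fun he => ?_
  have := (integral_eq_zero_iff_of_nonneg (fun _ => h.sqFn_nonneg _) (q.integrable_sqFn r hZ)).1
    he.symm
  obtain ⟨ω, h1, h2⟩ := (this.and h0).exists
  exact (h.sqFn_pos h2).ne' h1

/-- The terminal surplus is not deterministic if the current one has no atoms. -/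
lemma Regular.sq_integral_meanFn_lt (h : q.Regular r) (hZ : MemLp Z 2 μ)
    (hna : ∀ a : ℝ, ∀ᵐ ω ∂μ, Z ω ≠ a) :
    (∫ ω, q.meanFn r (Z ω) ∂μ) ^ 2 < ∫ ω, q.sqFn r (Z ω) ∂μ := by
  refine (h.sq_integral_meanFn_le hZ).lt_of_ne fun he => ?_
  have hm := q.memLp_meanFn r hZ
  have h1 := sq_integral_le_integral_sq hm
  have h2 := integral_mono hm.integrable_sq (q.integrable_sqFn r hZ)
    fun ω => h.meanFn_sq_le (Z ω)
  have h3 : (fun ω => q.meanFn r (Z ω) ^ 2) =ᵐ[μ] fun ω => q.sqFn r (Z ω) :=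
    (integral_eq_iff_of_ae_le hm.integrable_sq (q.integrable_sqFn r hZ)
      (.of_forall fun ω => h.meanFn_sq_le (Z ω))).1 (le_antisymm h2 (by rw [← he]; exact h1))
  have h4 : variance (fun ω => q.meanFn r (Z ω)) μ = 0 := by
    rw [variance_eq_sub hm, sub_eq_zero]
    exact le_antisymm (by rw [he]; exact h2) h1
  have h5 := ae_eq_integral_of_variance_eq_zero hm h4
  set c := ∫ ω, q.meanFn r (Z ω) ∂μ
  -- Equality would make `meanFn (Z)` almost surely the constant `c` and its square equal to `sqFn
  -- (Z)`, so `Z` would only take values among `c / (r + q.ap)`, `c / (r + q.am)` and `0`. At the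
  -- chosen `ω` the mean is nonzero, so the slope of the relevant branch is nonzero and the division
  -- is genuine.
  obtain ⟨ω, k3, k5, k0, kp, km⟩ := (h3.and (h5.and ((hna 0).and ((hna (c / (r + q.ap))).and
    (hna (c / (r + q.am))))))).exists
  have hpos := h.sqFn_pos k0
  have hne : q.meanFn r (Z ω) ≠ 0 := by
    intro h0
    simp only [h0] at k3
    rw [← k3] at hpos
    simp at hpos
  unfold meanFn at k5 hne
  split_ifs at k5 hne with hz
  · exact kp (by rw [eq_div_iff (left_ne_zero_of_mul hne), ← k5]; ring)
  · exact km (by rw [eq_div_iff (left_ne_zero_of_mul hne), ← k5]; ring)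

end FundParams

/-! ### Truncated integrals in terms of positive and negative parts. -/

section Truncation

variable {Ω : Type*} [MeasurableSpace Ω] {μ : Measure Ω} {Z Y : Ω → ℝ}

/-- The integrands vanish at `Z = 0`, so strict and weak indicators give the same integral. This and
its variants reduce `F^±` and the recursion to the first two moments of `max R 0` and `min R 0`. -/
lemma integral_ite_nonneg_mul (c : ℝ) :
    ∫ ω, (if 0 ≤ Z ω then c * Z ω else 0) ∂μ = c * ∫ ω, max (Z ω) 0 ∂μ := by
  rw [← integral_const_mul]
  congr with ω
  split_ifs with h
  · rw [max_eq_left h]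
  · rw [max_eq_right (not_le.1 h).le, mul_zero]

lemma integral_ite_pos_mul (c : ℝ) :
    ∫ ω, (if 0 < Z ω then c * Z ω else 0) ∂μ = c * ∫ ω, max (Z ω) 0 ∂μ := by
  rw [← integral_const_mul]
  congr with ω
  split_ifs with h
  · rw [max_eq_left h.le]
  · rw [max_eq_right (not_lt.1 h), mul_zero]

lemma integral_ite_nonpos_mul (c : ℝ) :
    ∫ ω, (if Z ω ≤ 0 then c * Z ω else 0) ∂μ = c * ∫ ω, min (Z ω) 0 ∂μ := by
  rw [← integral_const_mul]
  congr with ω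
  split_ifs with h
  · rw [min_eq_left h]
  · rw [min_eq_right (not_le.1 h).le, mul_zero]

lemma integral_ite_neg_mul (c : ℝ) :
    ∫ ω, (if Z ω < 0 then c * Z ω else 0) ∂μ = c * ∫ ω, min (Z ω) 0 ∂μ := by
  rw [← integral_const_mul]
  congr with ω
  split_ifs with h
  · rw [min_eq_left h.le]
  · rw [min_eq_right (not_lt.1 h), mul_zero]

lemma integral_ite_nonneg_mul_sq (c : ℝ) :
    ∫ ω, (if 0 ≤ Z ω then c * Z ω ^ 2 else 0) ∂μ = c * ∫ ω, max (Z ω) 0 ^ 2 ∂μ := by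
  rw [← integral_const_mul]
  congr with ω
  split_ifs with h
  · rw [max_eq_left h]
  · rw [max_eq_right (not_le.1 h).le]
    ring

lemma integral_ite_pos_mul_sq (c : ℝ) :
    ∫ ω, (if 0 < Z ω then c * Z ω ^ 2 else 0) ∂μ = c * ∫ ω, max (Z ω) 0 ^ 2 ∂μ := by
  rw [← integral_const_mul]
  congr with ω
  split_ifs with h
  · rw [max_eq_left h.le]
  · rw [max_eq_right (not_lt.1 h)]
    ring

lemma integral_ite_nonpos_mul_sq (c : ℝ) :
    ∫ ω, (if Z ω ≤ 0 then c * Z ω ^ 2 else 0) ∂μ = c * ∫ ω, min (Z ω) 0 ^ 2 ∂μ := by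
  rw [← integral_const_mul]
  congr with ω
  split_ifs with h
  · rw [min_eq_left h]
  · rw [min_eq_right (not_le.1 h).le]
    ring

lemma integral_ite_neg_mul_sq (c : ℝ) :
    ∫ ω, (if Z ω < 0 then c * Z ω ^ 2 else 0) ∂μ = c * ∫ ω, min (Z ω) 0 ^ 2 ∂μ := by
  rw [← integral_const_mul]
  congr with ω
  split_ifs with h
  · rw [min_eq_left h.le]
  · rw [min_eq_right (not_lt.1 h)]
    ring

lemma max_zero_memLp (hZ : MemLp Z 2 μ) : MemLp (fun ω => max (Z ω) 0) 2 μ := hZ.pos_part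

lemma min_zero_memLp (hZ : MemLp Z 2 μ) : MemLp (fun ω => min (Z ω) 0) 2 μ := by
  have h := hZ.neg_part.neg
  refine (memLp_congr_ae (.of_forall fun ω => ?_)).1 h
  simp only [Pi.neg_apply]
  rw [← neg_zero, max_neg_neg, neg_neg, neg_zero]

variable [IsProbabilityMeasure μ]

/-- The product of a truncated variable with its shift. -/
lemma integral_max_sub (hZ : MemLp Z 2 μ) (c s : ℝ) :
    ∫ ω, c * (max (Z ω) 0 ^ 2 - s * max (Z ω) 0) ∂μ
      = c * ((∫ ω, max (Z ω) 0 ^ 2 ∂μ) - s * ∫ ω, max (Z ω) 0 ∂μ) := by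
  have h := max_zero_memLp hZ
  rw [integral_const_mul, integral_sub h.integrable_sq ((h.integrable one_le_two).const_mul s),
    integral_const_mul]

lemma integral_min_sub (hZ : MemLp Z 2 μ) (c s : ℝ) :
    ∫ ω, c * (min (Z ω) 0 ^ 2 - s * min (Z ω) 0) ∂μ
      = c * ((∫ ω, min (Z ω) 0 ^ 2 ∂μ) - s * ∫ ω, min (Z ω) 0 ∂μ) := by
  have h := min_zero_memLp hZ
  rw [integral_const_mul, integral_sub h.integrable_sq ((h.integrable one_le_two).const_mul s),
    integral_const_mul]

/-- Meant for `Z = R` and `Y = P_t' K = R - s_t`, the cross terms in the recursion for `b_t^±`. -/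
lemma integral_ite_nonneg_mul_mul (hZ : MemLp Z 2 μ) (c s : ℝ) (hY : ∀ ω, Y ω = Z ω - s) :
    ∫ ω, (if 0 ≤ Z ω then c * Z ω * Y ω else 0) ∂μ
      = c * ((∫ ω, max (Z ω) 0 ^ 2 ∂μ) - s * ∫ ω, max (Z ω) 0 ∂μ) := by
  rw [← integral_max_sub hZ]
  congr with ω
  rw [hY]
  split_ifs with h
  · rw [max_eq_left h]
    ring
  · rw [max_eq_right (not_le.1 h).le]
    ring

lemma integral_ite_pos_mul_mul (hZ : MemLp Z 2 μ) (c s : ℝ) (hY : ∀ ω, Y ω = Z ω - s) :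
    ∫ ω, (if 0 < Z ω then c * Z ω * Y ω else 0) ∂μ
      = c * ((∫ ω, max (Z ω) 0 ^ 2 ∂μ) - s * ∫ ω, max (Z ω) 0 ∂μ) := by
  rw [← integral_max_sub hZ]
  congr with ω
  rw [hY]
  split_ifs with h
  · rw [max_eq_left h.le]
    ring
  · rw [max_eq_right (not_lt.1 h)]
    ring

lemma integral_ite_nonpos_mul_mul (hZ : MemLp Z 2 μ) (c s : ℝ) (hY : ∀ ω, Y ω = Z ω - s) :
    ∫ ω, (if Z ω ≤ 0 then c * Z ω * Y ω else 0) ∂μ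
      = c * ((∫ ω, min (Z ω) 0 ^ 2 ∂μ) - s * ∫ ω, min (Z ω) 0 ∂μ) := by
  rw [← integral_min_sub hZ]
  congr with ω
  rw [hY]
  split_ifs with h
  · rw [min_eq_left h]
    ring
  · rw [min_eq_right (not_le.1 h).le]
    ring

lemma integral_ite_neg_mul_mul (hZ : MemLp Z 2 μ) (c s : ℝ) (hY : ∀ ω, Y ω = Z ω - s) :
    ∫ ω, (if Z ω < 0 then c * Z ω * Y ω else 0) ∂μ
      = c * ((∫ ω, min (Z ω) 0 ^ 2 ∂μ) - s * ∫ ω, min (Z ω) 0 ∂μ) := by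
  rw [← integral_min_sub hZ]
  congr with ω
  rw [hY]
  split_ifs with h
  · rw [min_eq_left h.le]
    ring
  · rw [min_eq_right (not_lt.1 h)]
    ring

lemma integral_eq_max_add_min (hZ : MemLp Z 2 μ) :
    ∫ ω, Z ω ∂μ = (∫ ω, max (Z ω) 0 ∂μ) + ∫ ω, min (Z ω) 0 ∂μ := by
  rw [← integral_add ((max_zero_memLp hZ).integrable one_le_two)
    ((min_zero_memLp hZ).integrable one_le_two)]
  congr with ω
  rw [max_add_min, add_zero]

omit [IsProbabilityMeasure μ] in
lemma integral_sq_eq_max_add_min (hZ : MemLp Z 2 μ) :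
    ∫ ω, Z ω ^ 2 ∂μ = (∫ ω, max (Z ω) 0 ^ 2 ∂μ) + ∫ ω, min (Z ω) 0 ^ 2 ∂μ := by
  rw [← integral_add (max_zero_memLp hZ).integrable_sq (min_zero_memLp hZ).integrable_sq]
  congr with ω
  rcases le_total 0 (Z ω) with h | h <;> simp [h]

lemma FundParams.integral_meanFn (q : FundParams) (r : ℝ) (hZ : MemLp Z 2 μ) :
    ∫ ω, q.meanFn r (Z ω) ∂μ
      = (r + q.ap) * (∫ ω, max (Z ω) 0 ∂μ) + (r + q.am) * ∫ ω, min (Z ω) 0 ∂μ := by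
  simp only [q.meanFn_eq]
  rw [integral_add (((max_zero_memLp hZ).integrable one_le_two).const_mul _)
    (((min_zero_memLp hZ).integrable one_le_two).const_mul _), integral_const_mul,
    integral_const_mul]

omit [IsProbabilityMeasure μ] in
lemma FundParams.integral_sqFn (q : FundParams) (r : ℝ) (hZ : MemLp Z 2 μ) :
    ∫ ω, q.sqFn r (Z ω) ∂μ = (r ^ 2 + 2 * r * q.ap + q.bp) * (∫ ω, max (Z ω) 0 ^ 2 ∂μ)
      + (r ^ 2 + 2 * r * q.am + q.bm) * ∫ ω, min (Z ω) 0 ^ 2 ∂μ := by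
  simp only [q.sqFn_eq]
  rw [integral_add ((max_zero_memLp hZ).integrable_sq.const_mul _)
    ((min_zero_memLp hZ).integrable_sq.const_mul _), integral_const_mul,
    integral_const_mul]

/-- The lower fund is normalized at surplus `-1` with amounts `-K`, which leads to surplus `-R`;
positive and negative parts then trade places. -/
lemma FundParams.integral_meanFn_neg (q : FundParams) (r : ℝ) (hZ : MemLp Z 2 μ) :
    ∫ ω, q.meanFn r (-Z ω) ∂μ
      = -((r + q.ap) * (∫ ω, min (Z ω) 0 ∂μ) + (r + q.am) * ∫ ω, max (Z ω) 0 ∂μ) := by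
  rw [q.integral_meanFn r (Z := fun ω => -Z ω) hZ.neg]
  have h1 : ∀ ω, max (-Z ω) 0 = -min (Z ω) 0 := fun ω => by
    rw [← max_neg_neg, neg_zero]
  have h2 : ∀ ω, min (-Z ω) 0 = -max (Z ω) 0 := fun ω => by
    rw [← min_neg_neg, neg_zero]
  simp only [h1, h2, integral_neg]
  ring

omit [IsProbabilityMeasure μ] in
lemma FundParams.integral_sqFn_neg (q : FundParams) (r : ℝ) (hZ : MemLp Z 2 μ) :
    ∫ ω, q.sqFn r (-Z ω) ∂μ = (r ^ 2 + 2 * r * q.ap + q.bp) * (∫ ω, min (Z ω) 0 ^ 2 ∂μ)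
      + (r ^ 2 + 2 * r * q.am + q.bm) * ∫ ω, max (Z ω) 0 ^ 2 ∂μ := by
  rw [q.integral_sqFn r (Z := fun ω => -Z ω) hZ.neg]
  have h1 : ∀ ω, max (-Z ω) 0 = -min (Z ω) 0 := fun ω => by
    rw [← max_neg_neg, neg_zero]
  have h2 : ∀ ω, min (-Z ω) 0 = -max (Z ω) 0 := fun ω => by
    rw [← min_neg_neg, neg_zero]
  simp only [h1, h2, neg_sq]

end Truncation

/-! ### The one-step cost, its homogeneity, and its identification with `F^±`. -/

namespace ConeMarket

variable {Ω : Type*} [MeasurableSpace Ω] {n m : ℕ} (M : ConeMarket Ω n m) (μ : Measure Ω)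

/-- Conditional mean of the terminal surplus when the surplus is `c` and the amounts `v` are
invested at time `t`, with `q` the parameters at time `t + 1`. -/
def nextMean (t : ℕ) (q : FundParams) (c : ℝ) (v : Fin n → ℝ) : ℝ :=
  ∫ ω, q.meanFn (M.ρ (t + 1)) (M.s t * c + M.P t ω ⬝ᵥ v) ∂μ

/-- Conditional second moment of the terminal surplus when the surplus is `c` and the amounts `v`
are invested at time `t`, with `q` the parameters at time `t + 1`. -/
def nextSq (t : ℕ) (q : FundParams) (c : ℝ) (v : Fin n → ℝ) : ℝ :=
  ∫ ω, q.sqFn (M.ρ (t + 1)) (M.s t * c + M.P t ω ⬝ᵥ v) ∂μ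

/-- Conditional mean-variance objective with risk aversion `g`. -/
def nextCost (t : ℕ) (q : FundParams) (g c : ℝ) (v : Fin n → ℝ) : ℝ :=
  M.nextSq μ t q c v - M.nextMean μ t q c v ^ 2 - g * M.nextMean μ t q c v

variable {M μ} {t : ℕ} (q : FundParams)

lemma nextMean_mul {l : ℝ} (hl : 0 ≤ l) (c : ℝ) (v : Fin n → ℝ) :
    M.nextMean μ t q (l * c) (l • v) = l * M.nextMean μ t q c v := by
  rw [nextMean, nextMean, ← integral_const_mul]
  congr with ω
  rw [← q.meanFn_mul _ hl, dotProduct_smul, smul_eq_mul]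
  congr 1
  ring

lemma nextSq_mul {l : ℝ} (hl : 0 ≤ l) (c : ℝ) (v : Fin n → ℝ) :
    M.nextSq μ t q (l * c) (l • v) = l ^ 2 * M.nextSq μ t q c v := by
  rw [nextSq, nextSq, ← integral_const_mul]
  congr with ω
  rw [← q.sqFn_mul _ hl, dotProduct_smul, smul_eq_mul]
  congr 1
  ring

/-- Both moment functions are positively homogeneous. The factor on `g` matches a risk aversion
proportional to the absolute surplus, and this is why optimal policies are piecewise linear. -/
lemma nextCost_mul {l : ℝ} (hl : 0 ≤ l) (g c : ℝ) (v : Fin n → ℝ) :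
    M.nextCost μ t q (l * g) (l * c) (l • v) = l ^ 2 * M.nextCost μ t q g c v := by
  rw [nextCost, nextCost, nextMean_mul q hl, nextSq_mul q hl]
  ring

lemma abs_dotProduct_le (x y : Fin n → ℝ) : |x ⬝ᵥ y| ≤ n * (‖x‖ * ‖y‖) := by
  rw [dotProduct]
  refine (Finset.abs_sum_le_sum_abs _ _).trans ?_
  refine (Finset.sum_le_card_nsmul _ _ (‖x‖ * ‖y‖) fun i _ => ?_).trans (by simp)
  rw [abs_mul]
  exact mul_le_mul (norm_le_pi_norm x i) (norm_le_pi_norm y i) (abs_nonneg _) (norm_nonneg _)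

section

variable [IsProbabilityMeasure μ]

lemma memLp_P (he : MemLp (M.e t) 2 μ) : MemLp (M.P t) 2 μ :=
  he.sub (memLp_const (fun _ => M.s t))

omit [IsProbabilityMeasure μ] in
lemma memLp_P_apply (hP : MemLp (M.P t) 2 μ) (i : Fin n) : MemLp (fun ω => M.P t ω i) 2 μ :=
  MemLp.eval hP i

omit [IsProbabilityMeasure μ] in
lemma memLp_P_dotProduct (hP : MemLp (M.P t) 2 μ) (v : Fin n → ℝ) :
    MemLp (fun ω => M.P t ω ⬝ᵥ v) 2 μ :=
  memLp_finsetSum _ fun i _ => (memLp_P_apply hP i).mul_const (v i)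

lemma memLp_surplus (hP : MemLp (M.P t) 2 μ) (c : ℝ) (v : Fin n → ℝ) :
    MemLp (fun ω => M.s t * c + M.P t ω ⬝ᵥ v) 2 μ :=
  (memLp_const (M.s t * c)).add (memLp_P_dotProduct hP v)

lemma memLp_R (hP : MemLp (M.P t) 2 μ) (K : Fin n → ℝ) : MemLp (M.R t K) 2 μ :=
  (memLp_const (M.s t)).add (memLp_P_dotProduct hP K)

lemma meanP_dotProduct (hP : MemLp (M.P t) 2 μ) (K : Fin n → ℝ) :
    M.meanP μ t ⬝ᵥ K = (∫ ω, M.R t K ω ∂μ) - M.s t := by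
  simp only [R]
  rw [integral_add (integrable_const _) ((memLp_P_dotProduct hP K).integrable one_le_two)]
  simp only [integral_const, probReal_univ, one_smul, add_sub_cancel_left, dotProduct, meanP]
  rw [integral_finsetSum _ fun i _ => ((memLp_P_apply hP i).integrable one_le_two).mul_const (K i)]
  simp only [integral_mul_const]

lemma momentP_dotProduct (hP : MemLp (M.P t) 2 μ) (K : Fin n → ℝ) :
    K ⬝ᵥ (M.momentP μ t *ᵥ K)
      = (∫ ω, M.R t K ω ^ 2 ∂μ) - 2 * M.s t * (∫ ω, M.R t K ω ∂μ) + M.s t ^ 2 := by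
  have h1 : K ⬝ᵥ (M.momentP μ t *ᵥ K) = ∫ ω, (M.P t ω ⬝ᵥ K) ^ 2 ∂μ := by
    simp only [momentP, dotProduct, Matrix.mulVec, Matrix.of_apply, Finset.mul_sum]
    simp only [sq, Finset.sum_mul_sum]
    have hint : ∀ i j, Integrable (fun ω => M.P t ω i * K i * (M.P t ω j * K j)) μ := fun i j =>
      ((memLp_P_apply hP i).mul_const (K i)).integrable_mul ((memLp_P_apply hP j).mul_const (K j))
    rw [integral_finsetSum _ fun i _ => integrable_finsetSum _ fun j _ => hint i j]
    refine Finset.sum_congr rfl fun i _ => ?_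
    rw [integral_finsetSum _ fun j _ => hint i j]
    refine Finset.sum_congr rfl fun j _ => ?_
    rw [← integral_mul_const, ← integral_const_mul]
    congr with ω
    ring
  have hR := memLp_R hP K
  have h2 : ∀ ω, (M.P t ω ⬝ᵥ K) ^ 2
      = M.R t K ω ^ 2 + (M.s t ^ 2 - 2 * M.s t * M.R t K ω) := fun ω => by
    simp only [R]
    ring
  have h3 := (hR.integrable one_le_two).const_mul (2 * M.s t)
  have h4 : Integrable (fun ω => M.s t ^ 2 - 2 * M.s t * M.R t K ω) μ :=
    (integrable_const _).sub h3
  simp only [h1, h2]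
  rw [integral_add hR.integrable_sq h4,
    integral_sub (integrable_const _) h3, integral_const_mul]
  simp only [integral_const, probReal_univ, one_smul]
  ring

lemma nextMean_one (hP : MemLp (M.P t) 2 μ) (K : Fin n → ℝ) :
    M.nextMean μ t q 1 K = (M.ρ (t + 1) + q.ap) * (∫ ω, max (M.R t K ω) 0 ∂μ)
      + (M.ρ (t + 1) + q.am) * ∫ ω, min (M.R t K ω) 0 ∂μ := by
  rw [← q.integral_meanFn _ (memLp_R hP K), nextMean]
  simp only [R, mul_one]

lemma nextSq_one (hP : MemLp (M.P t) 2 μ) (K : Fin n → ℝ) :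
    M.nextSq μ t q 1 K
      = (M.ρ (t + 1) ^ 2 + 2 * M.ρ (t + 1) * q.ap + q.bp) * (∫ ω, max (M.R t K ω) 0 ^ 2 ∂μ)
      + (M.ρ (t + 1) ^ 2 + 2 * M.ρ (t + 1) * q.am + q.bm) * ∫ ω, min (M.R t K ω) 0 ^ 2 ∂μ := by
  rw [← q.integral_sqFn _ (memLp_R hP K), nextSq]
  simp only [R, mul_one]

lemma nextMean_neg_one (hP : MemLp (M.P t) 2 μ) (K : Fin n → ℝ) :
    M.nextMean μ t q (-1) (-K) = -((M.ρ (t + 1) + q.ap) * (∫ ω, min (M.R t K ω) 0 ∂μ)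
      + (M.ρ (t + 1) + q.am) * ∫ ω, max (M.R t K ω) 0 ∂μ) := by
  rw [← q.integral_meanFn_neg _ (memLp_R hP K), nextMean]
  simp only [R, mul_neg, mul_one, dotProduct_neg, neg_add]

lemma nextSq_neg_one (hP : MemLp (M.P t) 2 μ) (K : Fin n → ℝ) :
    M.nextSq μ t q (-1) (-K)
      = (M.ρ (t + 1) ^ 2 + 2 * M.ρ (t + 1) * q.ap + q.bp) * (∫ ω, min (M.R t K ω) 0 ^ 2 ∂μ)
      + (M.ρ (t + 1) ^ 2 + 2 * M.ρ (t + 1) * q.am + q.bm) * ∫ ω, max (M.R t K ω) 0 ^ 2 ∂μ := by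
  rw [← q.integral_sqFn_neg _ (memLp_R hP K), nextSq]
  simp only [R, mul_neg, mul_one, dotProduct_neg, neg_add]

omit [IsProbabilityMeasure μ] in
lemma covP_dotProduct (K : Fin n → ℝ) :
    K ⬝ᵥ ((M.momentP μ t - Matrix.vecMulVec (M.meanP μ t) (M.meanP μ t)) *ᵥ K)
      = K ⬝ᵥ (M.momentP μ t *ᵥ K) - (M.meanP μ t ⬝ᵥ K) ^ 2 := by
  rw [Matrix.sub_mulVec, dotProduct_sub, Matrix.vecMulVec_mulVec]
  simp only [op_smul_eq_smul, smul_dotProduct, smul_eq_mul, dotProduct_comm K]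
  ring

/-- Once expressed through the four truncated moments of `R`, both sides are the same polynomial. -/
lemma Fp_eq_nextCost (hP : MemLp (M.P t) 2 μ) (K : Fin n → ℝ) :
    M.Fp μ t q K = M.nextCost μ t q (M.γp t) 1 K := by
  have hR := memLp_R hP K
  rw [Fp, nextCost, nextMean_one q hP, nextSq_one q hP, covP_dotProduct, momentP_dotProduct hP,
    meanP_dotProduct hP, integral_ite_nonneg_mul, integral_ite_neg_mul, integral_ite_nonneg_mul_sq,
    integral_ite_neg_mul_sq, integral_eq_max_add_min hR, integral_sq_eq_max_add_min hR]
  ring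

lemma Fm_eq_nextCost (hP : MemLp (M.P t) 2 μ) (K : Fin n → ℝ) :
    M.Fm μ t q K = M.nextCost μ t q (M.γm t) (-1) (-K) := by
  have hR := memLp_R hP K
  rw [Fm, nextCost, nextMean_neg_one q hP, nextSq_neg_one q hP, covP_dotProduct,
    momentP_dotProduct hP,
    meanP_dotProduct hP, integral_ite_nonpos_mul, integral_ite_pos_mul, integral_ite_nonpos_mul_sq,
    integral_ite_pos_mul_sq, integral_eq_max_add_min hR, integral_sq_eq_max_add_min hR]
  ring

omit [MeasurableSpace Ω] in
lemma ρ_eq_mul (ht : t < M.T) : M.ρ t = M.s t * M.ρ (t + 1) := by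
  rw [ρ, ρ, Finset.prod_eq_prod_Ico_succ_bot ht]

omit [MeasurableSpace Ω] in
lemma P_dotProduct_eq (K : Fin n → ℝ) (ω : Ω) : M.P t ω ⬝ᵥ K = M.R t K ω - M.s t := by
  simp [R]

/-- Thus `a_t^+` is the excess of the optimal mean growth over the riskless growth `ρ_t`. With the
next three lemmas, the recursion says exactly that the moment functions at `t` are the one-step
moments at the normalized surpluses `1` and `-1`. -/
lemma step_ap (ht : t < M.T) (hP : MemLp (M.P t) 2 μ) (Kp Km : Fin n → ℝ) :
    M.ρ t + (M.step μ t Kp Km q).ap = M.nextMean μ t q 1 Kp := by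
  have hR := memLp_R hP Kp
  simp only [step]
  rw [nextMean_one q hP, meanP_dotProduct hP, integral_ite_nonneg_mul, integral_ite_neg_mul,
    integral_eq_max_add_min hR, ρ_eq_mul ht]
  ring

lemma step_am (ht : t < M.T) (hP : MemLp (M.P t) 2 μ) (Kp Km : Fin n → ℝ) :
    M.ρ t + (M.step μ t Kp Km q).am = -M.nextMean μ t q (-1) (-Km) := by
  have hR := memLp_R hP Km
  simp only [step]
  rw [nextMean_neg_one q hP, meanP_dotProduct hP, integral_ite_nonpos_mul,
    integral_ite_pos_mul, integral_eq_max_add_min hR, ρ_eq_mul ht]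
  ring

lemma step_bp (ht : t < M.T) (hP : MemLp (M.P t) 2 μ) (Kp Km : Fin n → ℝ) :
    M.ρ t ^ 2 + 2 * M.ρ t * (M.step μ t Kp Km q).ap + (M.step μ t Kp Km q).bp
      = M.nextSq μ t q 1 Kp := by
  have hR := memLp_R hP Kp
  simp only [step]
  rw [nextSq_one q hP, meanP_dotProduct hP, momentP_dotProduct hP, integral_ite_nonneg_mul,
    integral_ite_neg_mul, integral_ite_nonneg_mul_sq, integral_ite_neg_mul_sq,
    integral_ite_nonneg_mul_mul hR q.ap (M.s t) (fun ω => P_dotProduct_eq Kp ω),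
    integral_ite_neg_mul_mul hR q.am (M.s t) (fun ω => P_dotProduct_eq Kp ω),
    integral_eq_max_add_min hR, integral_sq_eq_max_add_min hR, ρ_eq_mul ht]
  ring

lemma step_bm (ht : t < M.T) (hP : MemLp (M.P t) 2 μ) (Kp Km : Fin n → ℝ) :
    M.ρ t ^ 2 + 2 * M.ρ t * (M.step μ t Kp Km q).am + (M.step μ t Kp Km q).bm
      = M.nextSq μ t q (-1) (-Km) := by
  have hR := memLp_R hP Km
  simp only [step]
  rw [nextSq_neg_one q hP, meanP_dotProduct hP, momentP_dotProduct hP,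
    integral_ite_nonpos_mul,
    integral_ite_pos_mul, integral_ite_nonpos_mul_sq, integral_ite_pos_mul_sq,
    integral_ite_nonpos_mul_mul hR q.ap (M.s t) (fun ω => P_dotProduct_eq Km ω),
    integral_ite_pos_mul_mul hR q.am (M.s t) (fun ω => P_dotProduct_eq Km ω),
    integral_eq_max_add_min hR, integral_sq_eq_max_add_min hR, ρ_eq_mul ht]
  ring

end

end ConeMarket

/-! ### Absence of atoms, attainment of the minima, and the backward scheme. -/

/-- An affine hyperplane is Lebesgue null. -/
lemma volume_dotProduct_eq {n : ℕ} {v : Fin n → ℝ} (hv : v ≠ 0) (d : ℝ) :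
    volume {x : Fin n → ℝ | x ⬝ᵥ v = d} = 0 := by
  have hw : 0 < v ⬝ᵥ v := by
    rw [lt_iff_le_and_ne]
    refine ⟨Finset.sum_nonneg fun i _ => mul_self_nonneg _, fun h => hv ?_⟩
    exact dotProduct_self_eq_zero.1 h.symm
  let S : AffineSubspace ℝ (Fin n → ℝ) :=
    { carrier := {x | x ⬝ᵥ v = d}
      smul_vsub_vadd_mem' := by
        intro c x y z hx hy hz
        simp only [Set.mem_ofPred_eq] at *
        simp [add_dotProduct, smul_dotProduct, sub_dotProduct, hx, hy, hz] }
  refine Measure.addHaar_affineSubspace volume S fun hS => ?_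
  have h : ∀ x : Fin n → ℝ, x ⬝ᵥ v = d := fun x => by
    have : x ∈ S := hS ▸ AffineSubspace.mem_top ℝ _ x
    exact this
  have h0 := h 0
  rw [zero_dotProduct] at h0
  exact hw.ne' ((h v).trans h0.symm)

namespace ConeMarket

variable {Ω : Type*} [MeasurableSpace Ω] {n m : ℕ} {M : ConeMarket Ω n m} {μ : Measure Ω}
  {t : ℕ} {q : FundParams}

/-- The exceptional event puts `e_t` on an affine hyperplane, which its absolutely continuous law
does not charge. -/
lemma surplus_ne_ae (he : Measurable (M.e t)) (hc : μ.map (M.e t) ≪ volume) {v : Fin n → ℝ}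
    (hv : v ≠ 0) (c a : ℝ) : ∀ᵐ ω ∂μ, M.s t * c + M.P t ω ⬝ᵥ v ≠ a := by
  have h : ∀ᵐ x ∂(μ.map (M.e t)), ¬ x ⬝ᵥ v = a - M.s t * c + ∑ i, M.s t * v i :=
    measure_eq_zero_iff_ae_notMem.1 (hc (volume_dotProduct_eq hv _))
  filter_upwards [ae_of_ae_map he.aemeasurable h] with ω hω h0
  apply hω
  rw [← h0]
  simp only [P, dotProduct, sub_mul, Finset.sum_sub_distrib]
  ring

variable [IsProbabilityMeasure μ]

/-- Dominated convergence: on the unit ball around `x₀`, quadratic growth of `f` and square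
integrability of `P_t` give one integrable bound. -/
lemma continuous_integral_surplus (hP : MemLp (M.P t) 2 μ) {f : ℝ → ℝ} (hf : Continuous f) {C : ℝ}
    (hC : 0 ≤ C) (hfC : ∀ z, |f z| ≤ C * (1 + |z| ^ 2)) :
    Continuous fun x : ℝ × (Fin n → ℝ) => ∫ ω, f (M.s t * x.1 + M.P t ω ⬝ᵥ x.2) ∂μ := by
  rw [continuous_iff_continuousAt]
  intro x₀
  have hD : MemLp (fun ω => |M.s t| * (‖x₀‖ + 1) + n * (‖M.P t ω‖ * (‖x₀‖ + 1))) 2 μ :=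
    (memLp_const (|M.s t| * (‖x₀‖ + 1))).add ((hP.norm.mul_const _).const_mul _)
  refine continuousAt_of_dominated (bound := fun ω =>
    C * (1 + (|M.s t| * (‖x₀‖ + 1) + n * (‖M.P t ω‖ * (‖x₀‖ + 1))) ^ 2)) ?_ ?_ ?_ ?_
  · exact .of_forall fun x => hf.comp_aestronglyMeasurable (memLp_surplus hP x.1 x.2).1
  · filter_upwards [Metric.ball_mem_nhds x₀ one_pos] with x hx
    have hx' : ‖x‖ ≤ ‖x₀‖ + 1 := by
      have := norm_le_norm_add_norm_sub' x x₀
      rw [← dist_eq_norm, dist_comm] at this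
      rw [Metric.mem_ball, dist_comm] at hx
      linarith
    refine .of_forall fun ω => (hfC _).trans ?_
    have h1 : |x.1| ≤ ‖x₀‖ + 1 := (norm_fst_le x).trans hx'
    have h2 : ‖x.2‖ ≤ ‖x₀‖ + 1 := (norm_snd_le x).trans hx'
    gcongr
    refine (abs_add_le _ _).trans ?_
    rw [abs_mul]
    gcongr
    exact (abs_dotProduct_le _ _).trans (by gcongr)
  · exact ((integrable_const 1).add hD.integrable_sq).const_mul C
  · refine .of_forall fun ω => (hf.comp ?_).continuousAt
    exact (continuous_const.mul continuous_fst).add (continuous_const.dotProduct continuous_snd)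

variable (q) in
lemma continuous_nextMean (hP : MemLp (M.P t) 2 μ) :
    Continuous fun x : ℝ × (Fin n → ℝ) => M.nextMean μ t q x.1 x.2 := by
  refine continuous_integral_surplus hP (q.continuous_meanFn _)
    (C := |M.ρ (t + 1) + q.ap| + |M.ρ (t + 1) + q.am|) (by positivity) fun z =>
    (q.abs_meanFn_le _ z).trans ?_
  gcongr
  nlinarith [sq_nonneg (|z| - 1), sq_nonneg |z|]

variable (q) in
lemma continuous_nextSq (hP : MemLp (M.P t) 2 μ) :
    Continuous fun x : ℝ × (Fin n → ℝ) => M.nextSq μ t q x.1 x.2 := by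
  refine continuous_integral_surplus hP (q.continuous_sqFn _)
    (C := |M.ρ (t + 1) ^ 2 + 2 * M.ρ (t + 1) * q.ap + q.bp|
      + |M.ρ (t + 1) ^ 2 + 2 * M.ρ (t + 1) * q.am + q.bm|) (by positivity) fun z =>
    (q.abs_sqFn_le _ z).trans ?_
  gcongr
  linarith

/-- Without risk aversion the cost is a variance, and a nonzero position makes the next surplus free
of atoms. -/
lemma nextCost_zero_pos (hP : MemLp (M.P t) 2 μ) (he : Measurable (M.e t))
    (hc : μ.map (M.e t) ≪ volume) (hq : q.Regular (M.ρ (t + 1))) {v : Fin n → ℝ} (hv : v ≠ 0)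
    (c : ℝ) : 0 < M.nextCost μ t q 0 c v := by
  rw [nextCost, zero_mul, sub_zero, sub_pos]
  exact hq.sq_integral_meanFn_lt (memLp_surplus hP c v) fun a => surplus_ne_ae he hc hv c a

/-- The conditional mean-variance objective is attained on any closed set containing zero. -/
lemma exists_isMinOn_nextCost (hP : MemLp (M.P t) 2 μ) (he : Measurable (M.e t))
    (hc : μ.map (M.e t) ≪ volume) (hq : q.Regular (M.ρ (t + 1))) (g c : ℝ)
    {S : Set (Fin n → ℝ)} (hS : IsClosed S) (h0 : 0 ∈ S) :
    ∃ v ∈ S, IsMinOn (M.nextCost μ t q g c) S v := by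
  have hcm := continuous_nextMean q hP
  have hcs := continuous_nextSq q hP
  have hcost : Continuous (M.nextCost μ t q g c) := by
    have h1 := hcm.comp (Continuous.prodMk_right c)
    have h2 := hcs.comp (Continuous.prodMk_right c)
    exact (h2.sub (h1.pow 2)).sub (h1.const_mul g)
  -- the homogenized difference of the objective and its value at zero
  have hΘ : Continuous fun x : ℝ × (Fin n → ℝ) =>
      M.nextCost μ t q (x.1 * g) (x.1 * c) x.2 - x.1 ^ 2 * M.nextCost μ t q g c 0 := by
    have hx : Continuous fun x : ℝ × (Fin n → ℝ) => (x.1 * c, x.2) := by fun_prop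
    have h1 := hcm.comp hx
    have h2 := hcs.comp hx
    exact ((h2.sub (h1.pow 2)).sub ((continuous_fst.mul_const g).mul h1)).sub
      ((continuous_fst.pow 2).mul_const _)
  -- At `ε = 0` the expression is the variance from zero surplus, positive at each unit vector;
  -- compactness of the sphere makes one neighbourhood of `0` work for all of them.
  have hev : ∀ᶠ ε in nhds (0 : ℝ), ∀ w ∈ Metric.sphere (0 : Fin n → ℝ) 1,
      0 < M.nextCost μ t q (ε * g) (ε * c) w - ε ^ 2 * M.nextCost μ t q g c 0 := by
    refine (isCompact_sphere _ _).eventually_forall_of_forall_eventually fun w hw => ?_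
    refine hΘ.continuousAt.eventually_const_lt ?_
    have hw0 : w ≠ 0 := fun h => by simp [h] at hw
    simpa using nextCost_zero_pos hP he hc hq hw0 0
  obtain ⟨δ, hδ, hball⟩ := Metric.eventually_nhds_iff.1 hev
  refine hcost.continuousOn.exists_isMinOn' hS h0 (Filter.Eventually.filter_mono inf_le_left ?_)
  filter_upwards [(isCompact_closedBall (0 : Fin n → ℝ) (1 / δ)).compl_mem_cocompact] with v hv
  have hvn : 1 / δ < ‖v‖ := by simpa using hv
  have hv0 : 0 < ‖v‖ := (one_div_pos.2 hδ).trans hvn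
  have hε : ‖v‖⁻¹ < δ := by
    rw [inv_lt_comm₀ hv0 hδ]
    simpa using hvn
  -- With `ε = ‖v‖⁻¹`, homogeneity turns the bound into `‖v‖⁻²` times the cost at `v` minus the cost
  -- at `0`.
  have h := hball (y := ‖v‖⁻¹) (by simpa using hε) (‖v‖⁻¹ • v) (by
    simp [norm_smul, hv0.ne'])
  rw [nextCost_mul q (inv_nonneg.2 hv0.le), ← mul_sub] at h
  exact (sub_pos.1 (pos_of_mul_pos_right h (sq_nonneg _))).le

omit [MeasurableSpace Ω] in
lemma isClosed_cone : IsClosed (M.cone t) := by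
  simp only [cone, Set.ofPred_forall]
  exact isClosed_iInter fun i => isClosed_le continuous_const (by
    simp only [Matrix.mulVec]
    exact continuous_const.dotProduct continuous_id)

omit [MeasurableSpace Ω] in
lemma zero_mem_cone : 0 ∈ M.cone t := fun i => by simp

omit [MeasurableSpace Ω] in
lemma smul_mem_cone {v : Fin n → ℝ} (hv : v ∈ M.cone t) {l : ℝ} (hl : 0 ≤ l) :
    l • v ∈ M.cone t := fun i => by
  rw [Matrix.mulVec_smul]
  exact mul_nonneg hl (hv i)

lemma exists_isArgminPlus (hP : MemLp (M.P t) 2 μ) (he : Measurable (M.e t))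
    (hc : μ.map (M.e t) ≪ volume) (hq : q.Regular (M.ρ (t + 1))) :
    ∃ k, M.IsArgminPlus μ t q k := by
  obtain ⟨v, hv, hmin⟩ :=
    exists_isMinOn_nextCost hP he hc hq (M.γp t) 1
      (isClosed_cone (M := M)) zero_mem_cone
  refine ⟨v, hv, fun w hw => ?_⟩
  simp only [Set.mem_ofPred_eq, Fp_eq_nextCost q hP]
  exact hmin hw

lemma exists_isArgminMinus (hP : MemLp (M.P t) 2 μ) (he : Measurable (M.e t))
    (hc : μ.map (M.e t) ≪ volume) (hq : q.Regular (M.ρ (t + 1))) :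
    ∃ k, M.IsArgminMinus μ t q k := by
  obtain ⟨v, hv, hmin⟩ :=
    exists_isMinOn_nextCost hP he hc hq (M.γm t) (-1)
      (isClosed_cone (M := M)) zero_mem_cone
  refine ⟨-v, by simpa using hv, fun w hw => ?_⟩
  simp only [Set.mem_ofPred_eq, Fm_eq_nextCost q hP, neg_neg]
  exact hmin (Set.mem_neg.1 hw)

omit [IsProbabilityMeasure μ] in
lemma surplus_ne_zero_ae (hs : 1 < M.s t) (he : Measurable (M.e t)) (hc : μ.map (M.e t) ≪ volume)
    {c : ℝ} (h0 : c ≠ 0) (v : Fin n → ℝ) : ∀ᵐ ω ∂μ, M.s t * c + M.P t ω ⬝ᵥ v ≠ 0 := by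
  rcases eq_or_ne v 0 with rfl | hv
  · refine .of_forall fun ω => ?_
    simp only [dotProduct_zero, add_zero]
    exact mul_ne_zero (by linarith) h0
  · exact surplus_ne_ae he hc hv c 0

/-- The funds are arbitrary: from surplus `±1` the next surplus is almost surely nonzero, even for a
zero fund since then it is `±s_t`. -/
lemma regular_step (ht : t < M.T) (hs : 1 < M.s t) (hP : MemLp (M.P t) 2 μ)
    (he : Measurable (M.e t)) (hc : μ.map (M.e t) ≪ volume) (hq : q.Regular (M.ρ (t + 1)))
    (Kp Km : Fin n → ℝ) : (M.step μ t Kp Km q).Regular (M.ρ t) where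
  pos_p := by
    rw [step_bp q ht hP]
    exact hq.integral_sqFn_pos (memLp_surplus hP _ _) (surplus_ne_zero_ae hs he hc one_ne_zero _)
  pos_m := by
    rw [step_bm q ht hP]
    exact hq.integral_sqFn_pos (memLp_surplus hP _ _)
      (surplus_ne_zero_ae hs he hc (neg_ne_zero.2 one_ne_zero) _)
  le_p := by
    rw [step_bp q ht hP, step_ap q ht hP]
    exact hq.sq_integral_meanFn_le (memLp_surplus hP _ _)
  le_m := by
    rw [step_bm q ht hP, step_am q ht hP, neg_sq]
    exact hq.sq_integral_meanFn_le (memLp_surplus hP _ _)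

omit [IsProbabilityMeasure μ] in
lemma params_of_lt (K : Funds n) (ht : t < M.T) :
    M.params μ K t = M.step μ t (K.p t) (K.m t) (M.params μ K (t + 1)) := by
  rw [params, if_pos ht]

omit [IsProbabilityMeasure μ] in
lemma params_of_le (K : Funds n) (ht : M.T ≤ t) : M.params μ K t = ⟨0, 0, 0, 0⟩ := by
  rw [params, if_neg (not_lt.2 ht)]

omit [MeasurableSpace Ω] in
lemma ρ_of_le (ht : M.T ≤ t) : M.ρ t = 1 := by
  rw [ρ, Finset.Ico_eq_empty (not_lt.2 ht), Finset.prod_empty]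

omit [MeasurableSpace Ω] in
lemma ρ_pos (hs : ∀ t < M.T, 1 < M.s t) (t : ℕ) : 0 < M.ρ t :=
  Finset.prod_pos fun j hj => zero_lt_one.trans (hs j (Finset.mem_Ico.1 hj).2)

lemma regular_params (hs : ∀ t < M.T, 1 < M.s t) (hmeas : ∀ t < M.T, Measurable (M.e t))
    (hL2 : ∀ t < M.T, MemLp (M.e t) 2 μ) (hcont : ∀ t < M.T, μ.map (M.e t) ≪ volume)
    (K : Funds n) (t : ℕ) : (M.params μ K t).Regular (M.ρ t) := by
  rcases lt_or_ge t M.T with ht | ht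
  · rw [params_of_lt K ht]
    exact regular_step ht (hs t ht) (memLp_P (hL2 t ht)) (hmeas t ht) (hcont t ht)
      (regular_params hs hmeas hL2 hcont K (t + 1)) _ _
  · rw [params_of_le K ht, ρ_of_le ht]
    constructor <;> norm_num
termination_by M.T - t

-- Lets the scheme change the funds at one date without disturbing the parameters of later dates.
omit [IsProbabilityMeasure μ] in
lemma params_congr {K L : Funds n} {t : ℕ} (hp : ∀ j, t ≤ j → K.p j = L.p j)
    (hm : ∀ j, t ≤ j → K.m j = L.m j) : M.params μ K t = M.params μ L t := by
  rcases lt_or_ge t M.T with ht | ht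
  · rw [params_of_lt K ht, params_of_lt L ht, hp t le_rfl, hm t le_rfl,
      params_congr (t := t + 1) (fun j hj => hp j (by omega)) (fun j hj => hm j (by omega))]
  · rw [params_of_le K ht, params_of_le L ht]
termination_by M.T - t

omit [IsProbabilityMeasure μ] in
/-- The backward scheme can be carried out from any date on. -/
lemma exists_optimalFrom
    (h : ∀ t < M.T, ∀ K : Funds n,
      (∃ k, M.IsArgminPlus μ t (M.params μ K (t + 1)) k) ∧
      (∃ k, M.IsArgminMinus μ t (M.params μ K (t + 1)) k)) (r : ℕ) :
    ∃ K : Funds n, M.OptimalFrom μ r K := by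
  rcases lt_or_ge r M.T with hr | hr
  · obtain ⟨K, hK⟩ := exists_optimalFrom h (r + 1)
    obtain ⟨⟨kp, hkp⟩, km, hkm⟩ := h r hr K
    have hpar : ∀ t, r < t →
        M.params μ ⟨Function.update K.p r kp, Function.update K.m r km⟩ t = M.params μ K t :=
      fun t ht => params_congr (fun j hj => Function.update_of_ne (by omega) _ _)
        (fun j hj => Function.update_of_ne (by omega) _ _)
    refine ⟨⟨Function.update K.p r kp, Function.update K.m r km⟩, fun t hrt ht => ?_⟩
    rw [hpar (t + 1) (by omega)]
    rcases hrt.eq_or_lt with rfl | hlt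
    · simpa using ⟨hkp, hkm⟩
    · simpa only [Function.update_of_ne hlt.ne'] using hK t hlt ht
  · exact ⟨⟨0, 0⟩, fun t h1 h2 => absurd h2 (by omega)⟩
termination_by M.T - r

end ConeMarket

/-! ### Conditional expectations and products under independence. -/

section Independence

/-- Under independence the joint law is a product, so the conditional distribution of `Y` given `X`
is the constant kernel. -/
lemma condExp_comap_of_indepFun {Ω β γ : Type*} [MeasurableSpace Ω] [mβ : MeasurableSpace β]
    [MeasurableSpace γ] [StandardBorelSpace γ] [Nonempty γ] {μ : Measure Ω} [IsProbabilityMeasure μ]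
    {X : Ω → β} {Y : Ω → γ} (hX : Measurable X) (hY : Measurable Y) (h : IndepFun X Y μ)
    {f : β × γ → ℝ} (hf : Measurable f) (hint : Integrable (fun ω => f (X ω, Y ω)) μ) :
    μ[fun ω => f (X ω, Y ω) | mβ.comap X] =ᵐ[μ] fun ω => ∫ ω', f (X ω, Y ω') ∂μ := by
  have : IsProbabilityMeasure (μ.map Y) := Measure.isProbabilityMeasure_map hY.aemeasurable
  have h1 : condDistrib Y X μ =ᵐ[μ.map X] Kernel.const β (μ.map Y) := by
    refine condDistrib_ae_eq_of_measure_eq_compProd X hY.aemeasurable ?_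
    rw [Measure.compProd_const]
    exact (indepFun_iff_map_prod_eq_prod_map_map hX.aemeasurable hY.aemeasurable).1 h
  filter_upwards [condExp_prod_ae_eq_integral_condDistrib hX hY.aemeasurable hf.stronglyMeasurable
    hint, ae_of_ae_map hX.aemeasurable h1] with ω hω h2
  rw [hω, h2, Kernel.const_apply, integral_map hY.aemeasurable]
  exact (hf.comp measurable_prodMk_left).aestronglyMeasurable

/-- Freezing lemma: `X` is known and `Y` is independent of the conditioning σ-algebra. -/
lemma condExp_prod_of_indep {Ω β γ : Type*} {m m0 : MeasurableSpace Ω} [MeasurableSpace β]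
    [MeasurableSpace γ] [StandardBorelSpace γ] [Nonempty γ] {μ : Measure Ω} [IsProbabilityMeasure μ]
    (hm : m ≤ m0) {X : Ω → β} {Y : Ω → γ} (hX : Measurable[m] X) (hY : Measurable Y)
    (h : Indep m (MeasurableSpace.comap Y inferInstance) μ)
    {f : β × γ → ℝ} (hf : Measurable f) (hint : Integrable (fun ω => f (X ω, Y ω)) μ) :
    μ[fun ω => f (X ω, Y ω) | m] =ᵐ[μ] fun ω => ∫ ω', f (X ω, Y ω') ∂μ := by
  have hg : Measurable[m.prod inferInstance] fun p : Ω × γ => f (X p.1, p.2) := by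
    let _ : MeasurableSpace Ω := m
    exact hf.comp ((hX.comp measurable_fst).prodMk measurable_snd)
  -- The conditioning variable is the identity into `Ω` equipped with `m`, whose generated σ-algebra
  -- is `m` itself.
  have hid : @IndepFun Ω Ω γ m0 m inferInstance id Y μ := by
    refine (@IndepFun_iff_Indep Ω Ω γ m0 m _ id Y μ).2 ?_
    rwa [MeasurableSpace.comap_id]
  have := @condExp_comap_of_indepFun Ω Ω γ m0 m _ _ _ μ _ id Y (measurable_id'' hm) hY hid _ hg hint
  simpa only [MeasurableSpace.comap_id, id] using this

/-- The squares are independent and integrable, hence so is their product. Applied to `P_t` and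
`u_t`, this keeps wealth square integrable. -/
lemma ProbabilityTheory.IndepFun.memLp_mul {Ω : Type*} [MeasurableSpace Ω] {μ : Measure Ω} {f g : Ω → ℝ}
    (h : IndepFun f g μ) (hf : MemLp f 2 μ) (hg : MemLp g 2 μ) :
    MemLp (fun ω => f ω * g ω) 2 μ := by
  change MemLp (f * g) 2 μ
  refine (memLp_two_iff_integrable_sq (hf.1.mul hg.1)).2 ?_
  simp only [Pi.mul_apply, mul_pow]
  exact (h.comp (measurable_id.pow_const 2) (measurable_id.pow_const 2)).integrable_mul
    hf.integrable_sq hg.integrable_sq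

end Independence

/-! ### Surplus dynamics, the filtration of returns, and admissibility. -/

namespace ConeMarket

variable {Ω : Type*} {n m : ℕ} {M : ConeMarket Ω n m} {t : ℕ} {x0 : ℝ}
  {u w : ℕ → ℝ → (Fin n → ℝ)}

lemma wealth_congr (h : ∀ j < t, u j = w j) : M.wealth x0 u t = M.wealth x0 w t := by
  induction t with
  | zero => rfl
  | succ t ih =>
    funext ω
    simp only [wealth, ih fun j hj => h j (by omega), h t t.lt_succ_self]

/-- The wealth in excess of the discounted target. -/
def surplus (M : ConeMarket Ω n m) (x0 : ℝ) (u : ℕ → ℝ → (Fin n → ℝ)) (t : ℕ) (ω : Ω) : ℝ :=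
  M.wealth x0 u t ω - (M.ρ t)⁻¹ * M.W

/-- The discounted target itself grows at the riskless rate, so `W` drops out. -/
lemma surplus_succ (hs : ∀ t < M.T, 1 < M.s t) (ht : t < M.T) (ω : Ω) :
    M.surplus x0 u (t + 1) ω
      = M.s t * M.surplus x0 u t ω + M.P t ω ⬝ᵥ u t (M.wealth x0 u t ω) := by
  have h1 := (ρ_pos hs (t + 1)).ne'
  have h2 := hs t ht
  have h3 : M.s t ≠ 0 := by linarith
  simp only [surplus, wealth, ρ_eq_mul ht, mul_inv]
  field_simp
  ring

lemma wealth_T_eq (ω : Ω) : M.wealth x0 u M.T ω = M.surplus x0 u M.T ω + M.W := by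
  simp [surplus, ρ_of_le]

lemma feedback_eq (K : Funds n) (x : ℝ) :
    M.feedback K t x = max (x - (M.ρ t)⁻¹ * M.W) 0 • K.p t
      + min (x - (M.ρ t)⁻¹ * M.W) 0 • K.m t := by
  rw [feedback]
  split_ifs with h
  · simp [h]
  · simp [(not_le.1 h).le]

lemma continuous_feedback (K : Funds n) : Continuous (M.feedback K t) := by
  simp only [funext (feedback_eq K)]
  fun_prop

lemma norm_feedback_le (K : Funds n) (x : ℝ) :
    ‖M.feedback K t x‖ ≤ (‖K.p t‖ + ‖K.m t‖) * ‖x - (M.ρ t)⁻¹ * M.W‖ := by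
  rw [feedback]
  split_ifs
  · rw [norm_smul, mul_comm]
    gcongr
    linarith [norm_nonneg (K.m t)]
  · rw [norm_smul, mul_comm]
    gcongr
    linarith [norm_nonneg (K.p t)]

/-- Below the target a negative surplus multiplies a fund from the opposite cone. -/
lemma feedback_mem_cone {K : Funds n} (hp : K.p t ∈ M.cone t) (hm : K.m t ∈ -M.cone t) (x : ℝ) :
    M.feedback K t x ∈ M.cone t := by
  rw [feedback]
  split_ifs with h
  · exact smul_mem_cone hp (sub_nonneg.2 h)
  · have := smul_mem_cone (Set.mem_neg.1 hm) (l := -(x - (M.ρ t)⁻¹ * M.W)) (by linarith)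
    rwa [smul_neg, neg_smul, neg_neg] at this

/-- The information generated by the returns before time `t`. -/
@[reducible] def past (M : ConeMarket Ω n m) (t : ℕ) : MeasurableSpace Ω :=
  ⨆ j ∈ {j : Fin M.T | (j : ℕ) < t}, MeasurableSpace.comap (M.e j) inferInstance

lemma past_mono {r : ℕ} (h : t ≤ r) : M.past t ≤ M.past r :=
  biSup_mono fun _ hj => lt_of_lt_of_le hj h

lemma measurable_e_past {j : ℕ} (hj : j < t) (hT : j < M.T) : Measurable[M.past t] (M.e j) := by
  rw [measurable_iff_comap_le]
  exact le_biSup (fun j : Fin M.T => MeasurableSpace.comap (M.e j) inferInstance)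
    (show (⟨j, hT⟩ : Fin M.T) ∈ {j : Fin M.T | (j : ℕ) < t} from hj)

lemma measurable_P_of_measurable_e {mΩ : MeasurableSpace Ω} (h : Measurable (M.e t)) :
    Measurable (M.P t) :=
  measurable_pi_iff.2 fun i => ((measurable_pi_apply i).comp h).sub_const _

lemma measurable_dotProduct {mΩ : MeasurableSpace Ω} {f g : Ω → Fin n → ℝ} (hf : Measurable f)
    (hg : Measurable g) : Measurable fun ω => f ω ⬝ᵥ g ω :=
  Finset.measurable_sum _ fun i _ =>
    ((measurable_pi_apply i).comp hf).mul ((measurable_pi_apply i).comp hg)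

lemma measurable_wealth_past (ht : t ≤ M.T) (hu : ∀ j < t, Measurable (u j)) :
    Measurable[M.past t] (M.wealth x0 u t) := by
  induction t with
  | zero => exact @measurable_const _ _ _ (M.past 0) x0
  | succ t ih =>
    have h1 : Measurable[M.past (t + 1)] (M.wealth x0 u t) :=
      (ih (by omega) fun j hj => hu j (by omega)).mono (past_mono t.le_succ) le_rfl
    have h2 := measurable_P_of_measurable_e (measurable_e_past (M := M) t.lt_succ_self ht)
    exact (h1.const_mul _).add (measurable_dotProduct h2 ((hu t t.lt_succ_self).comp h1))

variable [mΩ : MeasurableSpace Ω] {μ : Measure Ω}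

/-- The standing assumptions on the returns. -/
structure Standing (M : ConeMarket Ω n m) (μ : Measure Ω) : Prop where
  one_lt_s : ∀ t < M.T, 1 < M.s t
  meas : ∀ t < M.T, Measurable (M.e t)
  indep : iIndepFun (fun t : Fin M.T => M.e t) μ
  memLp : ∀ t < M.T, MemLp (M.e t) 2 μ
  cont : ∀ t < M.T, μ.map (M.e t) ≪ volume

namespace Standing

lemma past_le (h : M.Standing μ) : M.past t ≤ mΩ :=
  iSup₂_le fun j _ => (h.meas j j.2).comap_le

lemma indep_past (h : M.Standing μ) (ht : t < M.T) :
    Indep (M.past t) (MeasurableSpace.comap (M.P t) inferInstance) μ := by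
  have h1 := indep_iSup_of_disjoint (fun j : Fin M.T => (h.meas j j.2).comap_le) h.indep.iIndep
    (S := {j : Fin M.T | (j : ℕ) < t}) (T := {⟨t, ht⟩}) (by simp)
  simp only [Set.mem_singleton_iff, iSup_iSup_eq_left] at h1
  refine indep_of_indep_of_le_right h1 (measurable_iff_comap_le.1 ?_)
  exact measurable_P_of_measurable_e (comap_measurable (M.e t))

lemma measurable_P (h : M.Standing μ) (ht : t < M.T) : Measurable (M.P t) :=
  measurable_P_of_measurable_e (h.meas t ht)

lemma measurable_surplus (hu : M.Admissible μ x0 u) (ht : t ≤ M.T) :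
    Measurable[M.past t] (M.surplus x0 u t) :=
  (measurable_wealth_past ht fun j hj => (hu j (by omega)).1).sub_const _

variable [IsProbabilityMeasure μ]

lemma memLp_P (h : M.Standing μ) (ht : t < M.T) : MemLp (M.P t) 2 μ :=
  ConeMarket.memLp_P (h.memLp t ht)

lemma regular (h : M.Standing μ) (K : Funds n) (t : ℕ) : (M.params μ K t).Regular (M.ρ t) :=
  regular_params h.one_lt_s h.meas h.memLp h.cont K t

lemma memLp_wealth (h : M.Standing μ) (ht : t ≤ M.T) (hu : ∀ j < t, Measurable (u j))
    (hL : ∀ j < t, MemLp (fun ω => u j (M.wealth x0 u j ω)) 2 μ) :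
    MemLp (M.wealth x0 u t) 2 μ := by
  induction t with
  | zero => exact memLp_const x0
  | succ t ih =>
    have h1 := ih (by omega) (fun j hj => hu j (by omega)) (fun j hj => hL j (by omega))
    refine (h1.const_mul (M.s t)).add (memLp_finsetSum _ fun i _ => ?_)
    refine IndepFun.memLp_mul (IndepFun.symm ?_) (memLp_P_apply (h.memLp_P ht) i)
      (MemLp.eval (hL t t.lt_succ_self) i)
    rw [IndepFun_iff_Indep]
    refine indep_of_indep_of_le_left (indep_of_indep_of_le_right (h.indep_past ht) ?_) ?_
    · exact measurable_iff_comap_le.1 ((measurable_pi_apply i).comp (comap_measurable (M.P t)))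
    · exact measurable_iff_comap_le.1 ((measurable_pi_apply i).comp ((hu t t.lt_succ_self).comp
        (measurable_wealth_past (by omega) fun j hj => hu j (by omega))))

lemma memLp_surplus (h : M.Standing μ) (hu : M.Admissible μ x0 u) (ht : t ≤ M.T) :
    MemLp (M.surplus x0 u t) 2 μ :=
  (h.memLp_wealth ht (fun j hj => (hu j (by omega)).1) (fun j hj => (hu j (by omega)).2.2)).sub
    (memLp_const _)

/-- Following a feedback policy from some date on is admissible. -/
lemma admissible_of_eq_feedback (h : M.Standing μ) {K : Funds n} (hK : M.OptimalFrom μ 0 K) {r : ℕ}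
    (hlt : ∀ j < r, j < M.T → Measurable (u j) ∧ (∀ x, u j x ∈ M.cone j) ∧
      MemLp (fun ω => u j (M.wealth x0 u j ω)) 2 μ)
    (hge : ∀ j, r ≤ j → j < M.T → u j = M.feedback K j) : M.Admissible μ x0 u := by
  intro j hj
  induction j using Nat.strong_induction_on with
  | _ j ih =>
    rcases lt_or_ge j r with hr | hr
    · exact hlt j hr hj
    · rw [hge j hr hj]
      have hX := h.memLp_wealth (x0 := x0) (u := u) hj.le (fun i hi => (ih i hi (by omega)).1)
        (fun i hi => (ih i hi (by omega)).2.2)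
      have hk := hK j (Nat.zero_le _) hj
      refine ⟨(continuous_feedback K).measurable, feedback_mem_cone hk.1.1 hk.2.1, ?_⟩
      exact MemLp.of_le_mul (hX.sub (memLp_const ((M.ρ j)⁻¹ * M.W)))
        ((continuous_feedback K).comp_aestronglyMeasurable hX.1)
        (.of_forall fun ω => norm_feedback_le K _)

end Standing

end ConeMarket

/-! ### Conditional moments of the terminal surplus and the objective. -/

namespace ConeMarket

variable {Ω : Type*} {n m : ℕ} {M : ConeMarket Ω n m} {t : ℕ} {x0 : ℝ}
  {u : ℕ → ℝ → (Fin n → ℝ)} [mΩ : MeasurableSpace Ω] {μ : Measure Ω} [IsProbabilityMeasure μ]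

/-- Homogeneity with factor `|c|` reduces to `(1, K.p t)` above the target and to `(-1, -K.m t)`
below it. -/
lemma nextMean_feedback (q : FundParams) (ht : t < M.T) (hP : MemLp (M.P t) 2 μ) (K : Funds n)
    (x : ℝ) : M.nextMean μ t q (x - (M.ρ t)⁻¹ * M.W) (M.feedback K t x)
      = (M.step μ t (K.p t) (K.m t) q).meanFn (M.ρ t) (x - (M.ρ t)⁻¹ * M.W) := by
  set c := x - (M.ρ t)⁻¹ * M.W with hc
  rw [FundParams.meanFn, feedback, ← hc]
  by_cases h : 0 ≤ c
  · rw [if_pos h, if_pos (sub_nonneg.1 h), step_ap q ht hP]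
    have := nextMean_mul q (M := M) (μ := μ) (t := t) h 1 (K.p t)
    rw [mul_one] at this
    rw [this, mul_comm]
  · rw [if_neg h, if_neg (by rwa [← sub_nonneg]), step_am q ht hP]
    have := nextMean_mul q (M := M) (μ := μ) (t := t) (l := -c) (by linarith) (-1) (-K.m t)
    rw [smul_neg, neg_smul, neg_neg, mul_neg_one, neg_neg] at this
    rw [this]
    ring

lemma nextSq_feedback (q : FundParams) (ht : t < M.T) (hP : MemLp (M.P t) 2 μ) (K : Funds n)
    (x : ℝ) : M.nextSq μ t q (x - (M.ρ t)⁻¹ * M.W) (M.feedback K t x)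
      = (M.step μ t (K.p t) (K.m t) q).sqFn (M.ρ t) (x - (M.ρ t)⁻¹ * M.W) := by
  set c := x - (M.ρ t)⁻¹ * M.W with hc
  rw [FundParams.sqFn, feedback, ← hc]
  by_cases h : 0 ≤ c
  · rw [if_pos h, if_pos (sub_nonneg.1 h), step_bp q ht hP]
    have := nextSq_mul q (M := M) (μ := μ) (t := t) h 1 (K.p t)
    rw [mul_one] at this
    rw [this, mul_comm]
  · rw [if_neg h, if_neg (by rwa [← sub_nonneg]), step_bm q ht hP]
    have := nextSq_mul q (M := M) (μ := μ) (t := t) (l := -c) (by linarith) (-1) (-K.m t)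
    rw [smul_neg, neg_smul, neg_neg, mul_neg_one, neg_neg] at this
    rw [this]
    ring

namespace Standing

/-- One backward step of a conditional expectation along the surplus process. -/
lemma condExp_past (h : M.Standing μ) (hu : M.Admissible μ x0 u) (ht : t < M.T) {f : Ω → ℝ}
    {g : ℝ → ℝ} (hg : Continuous g)
    (hfg : μ[f | M.past (t + 1)] =ᵐ[μ] fun ω => g (M.surplus x0 u (t + 1) ω)) :
    μ[f | M.past t] =ᵐ[μ] fun ω =>
      ∫ ω', g (M.s t * M.surplus x0 u t ω + M.P t ω' ⬝ᵥ u t (M.wealth x0 u t ω)) ∂μ := by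
  have h1 : μ[f | M.past t] =ᵐ[μ] μ[fun ω => g (M.surplus x0 u (t + 1) ω) | M.past t] :=
    (condExp_condExp_of_le (past_mono t.le_succ) h.past_le).symm.trans (condExp_congr_ae hfg)
  refine h1.trans ?_
  have hint : Integrable (fun ω => g (M.surplus x0 u (t + 1) ω)) μ :=
    integrable_condExp.congr hfg
  simp only [surplus_succ h.one_lt_s ht] at hint ⊢
  have hX := measurable_wealth_past (M := M) (x0 := x0) (u := u) ht.le
    fun j hj => (hu j (by omega)).1
  refine condExp_prod_of_indep h.past_le
    (X := fun ω => (M.s t * M.surplus x0 u t ω, u t (M.wealth x0 u t ω)))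
    (((measurable_surplus hu ht.le).const_mul _).prodMk ((hu t ht).1.comp hX))
    (h.measurable_P ht) (h.indep_past ht)
    (f := fun p => g (p.1.1 + p.2 ⬝ᵥ p.1.2)) ?_ hint
  exact hg.measurable.comp (measurable_fst.fst.add
    (measurable_dotProduct measurable_snd measurable_fst.snd))

/-- First two conditional moments of the terminal surplus along a feedback policy. -/
lemma condExp_surplus (h : M.Standing μ) (hu : M.Admissible μ x0 u) (K : Funds n) (t : ℕ)
    (ht : t ≤ M.T) (hK : ∀ j, t ≤ j → j < M.T → u j = M.feedback K j) :
    μ[M.surplus x0 u M.T | M.past t] =ᵐ[μ]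
        (fun ω => (M.params μ K t).meanFn (M.ρ t) (M.surplus x0 u t ω)) ∧
      μ[fun ω => M.surplus x0 u M.T ω ^ 2 | M.past t] =ᵐ[μ]
        fun ω => (M.params μ K t).sqFn (M.ρ t) (M.surplus x0 u t ω) := by
  rcases ht.lt_or_eq with ht' | rfl
  · obtain ⟨h1, h2⟩ := condExp_surplus h hu K (t + 1) ht' fun j hj => hK j (by omega)
    have hP := h.memLp_P ht'
    constructor
    · refine (h.condExp_past hu ht' (FundParams.continuous_meanFn _ _) h1).trans
        (.of_forall fun ω => ?_)
      rw [params_of_lt K ht']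
      simp only [surplus]
      rw [← nextMean_feedback _ ht' hP, hK t le_rfl ht', nextMean]
    · refine (h.condExp_past hu ht' (FundParams.continuous_sqFn _ _) h2).trans
        (.of_forall fun ω => ?_)
      rw [params_of_lt K ht']
      simp only [surplus]
      rw [← nextSq_feedback _ ht' hP, hK t le_rfl ht', nextSq]
  · have hm := (measurable_surplus hu le_rfl).stronglyMeasurable
    have hL := h.memLp_surplus hu le_rfl
    have h2 : μ[fun ω => M.surplus x0 u M.T ω ^ 2 | M.past M.T] = _ :=
      condExp_of_stronglyMeasurable h.past_le (hm.pow 2) hL.integrable_sq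
    rw [params_of_le K le_rfl, ρ_of_le le_rfl,
      condExp_of_stronglyMeasurable h.past_le hm (hL.integrable one_le_two), h2]
    constructor <;> refine .of_forall fun ω => ?_
    · simp [FundParams.meanFn]
    · simp [FundParams.sqFn]
termination_by M.T - t

/-- The objective, for an arbitrary decision at time `t` followed by feedback decisions. -/
lemma objective_eq (h : M.Standing μ) (hu : M.Admissible μ x0 u) (K : Funds n)
    (ht : t < M.T) (hK : ∀ j, t < j → j < M.T → u j = M.feedback K j) :
    M.objective μ x0 u t =ᵐ[μ] fun ω =>
      M.nextCost μ t (M.params μ K (t + 1)) (M.riskAversion t (M.wealth x0 u t ω))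
        (M.wealth x0 u t ω - (M.ρ t)⁻¹ * M.W) (u t (M.wealth x0 u t ω))
      - M.riskAversion t (M.wealth x0 u t ω) * M.W := by
  set q := M.params μ K (t + 1)
  set X := M.wealth x0 u t
  set Y := M.surplus x0 u M.T
  have hX : Measurable[M.past t] X := measurable_wealth_past ht.le fun j hj => (hu j (by omega)).1
  have hle : MeasurableSpace.comap X (borel ℝ) ≤ M.past t := hX.comap_le
  have hle' := hle.trans h.past_le
  have hL : MemLp Y 2 μ := h.memLp_surplus hu le_rfl
  have hP := h.memLp_P ht
  obtain ⟨h1, h2⟩ := h.condExp_surplus hu K (t + 1) ht fun j hj => hK j (by omega)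
  have k1 := h.condExp_past hu ht (FundParams.continuous_meanFn _ _) h1
  have k2 := h.condExp_past hu ht (FundParams.continuous_sqFn _ _) h2
  have hpair : Measurable fun x : ℝ => (x - (M.ρ t)⁻¹ * M.W, u t x) :=
    (measurable_id.sub_const _).prodMk (hu t ht).1
  -- Given the whole past, the conditional expectation already depends on `X_t` only, so by the
  -- tower property conditioning on `X_t` alone gives the same function.
  have reduce : ∀ (f : Ω → ℝ) (G : ℝ × (Fin n → ℝ) → ℝ), Continuous G →
      μ[f | M.past t] =ᵐ[μ] (fun ω => G (X ω - (M.ρ t)⁻¹ * M.W, u t (X ω))) →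
      μ[f | MeasurableSpace.comap X (borel ℝ)] =ᵐ[μ]
        fun ω => G (X ω - (M.ρ t)⁻¹ * M.W, u t (X ω)) := by
    intro f G hG hf
    refine (condExp_condExp_of_le hle h.past_le).symm.trans ((condExp_congr_ae hf).trans ?_)
    rw [condExp_of_stronglyMeasurable hle']
    · exact ((hG.measurable.comp hpair).comp (comap_measurable X)).stronglyMeasurable
    · exact integrable_condExp.congr hf
  have l1 := reduce Y _ (continuous_nextMean q hP) k1
  have l2 := reduce (fun ω => Y ω ^ 2) _ (continuous_nextSq q hP) k2
  -- The constant `W` leaves the variance unchanged and shifts the mean; this yields the last term,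
  -- which does not involve the decision at `t`.
  have hT : M.wealth x0 u M.T = Y + fun _ => M.W := funext fun ω => wealth_T_eq ω
  have hmean : μ[M.wealth x0 u M.T | MeasurableSpace.comap X (borel ℝ)] =ᵐ[μ]
      μ[Y | MeasurableSpace.comap X (borel ℝ)] + fun _ => M.W := by
    rw [hT]
    refine (condExp_add (hL.integrable one_le_two) (integrable_const M.W) _).trans ?_
    rw [condExp_const hle']
  have hvar : condVar (MeasurableSpace.comap X (borel ℝ)) (M.wealth x0 u M.T) μ =ᵐ[μ]
      condVar (MeasurableSpace.comap X (borel ℝ)) Y μ := by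
    refine condExp_congr_ae ?_
    filter_upwards [hmean] with ω hω
    simp only [Pi.pow_apply, Pi.sub_apply, hω, Pi.add_apply, wealth_T_eq, add_sub_add_right_eq_sub,
      Y]
  filter_upwards [hmean, hvar, condVar_ae_eq_condExp_sq_sub_sq_condExp hle' hL, l1, l2]
    with ω e1 e2 e3 e4 e5
  simp only [Pi.sub_apply, Pi.pow_apply, Pi.add_apply] at e1 e3
  have e6 : (μ[Y ^ 2 | MeasurableSpace.comap X (borel ℝ)]) ω = _ := e5
  rw [objective, e2, e1, e3, e4, e6, nextCost]
  ring

end Standing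

end ConeMarket

/-! ### Pointwise optimality, time consistency and uniqueness. -/

namespace ConeMarket

variable {Ω : Type*} {n m : ℕ} {M : ConeMarket Ω n m} {t : ℕ} {x : ℝ} {q : FundParams}
  [mΩ : MeasurableSpace Ω] {μ : Measure Ω} [IsProbabilityMeasure μ]

lemma nextCost_of_pos (hP : MemLp (M.P t) 2 μ) (h : 0 < x - (M.ρ t)⁻¹ * M.W) (v : Fin n → ℝ) :
    M.nextCost μ t q (M.riskAversion t x) (x - (M.ρ t)⁻¹ * M.W) v
      = (x - (M.ρ t)⁻¹ * M.W) ^ 2 * M.Fp μ t q ((x - (M.ρ t)⁻¹ * M.W)⁻¹ • v) := by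
  rw [riskAversion, if_pos (sub_pos.1 h).le, Fp_eq_nextCost q hP, ← nextCost_mul q h.le,
    smul_inv_smul₀ h.ne', mul_one, mul_comm]

lemma nextCost_of_neg (hP : MemLp (M.P t) 2 μ) (h : x - (M.ρ t)⁻¹ * M.W < 0) (v : Fin n → ℝ) :
    M.nextCost μ t q (M.riskAversion t x) (x - (M.ρ t)⁻¹ * M.W) v
      = (x - (M.ρ t)⁻¹ * M.W) ^ 2 * M.Fm μ t q ((x - (M.ρ t)⁻¹ * M.W)⁻¹ • v) := by
  rw [riskAversion, if_neg (not_le.2 (sub_neg.1 h)), Fm_eq_nextCost q hP, ← neg_sq,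
    ← nextCost_mul q (neg_pos.2 h).le, smul_neg, neg_smul, neg_neg,
    smul_inv_smul₀ h.ne, mul_neg_one, neg_neg]
  congr 1
  ring

omit [IsProbabilityMeasure μ] in
lemma nextCost_zero_zero (q : FundParams) : M.nextCost μ t q 0 0 0 = 0 := by
  simpa using nextCost_mul (M := M) (μ := μ) (t := t) q (le_refl 0) 0 0 0

omit mΩ in
lemma riskAversion_of_eq (h : x - (M.ρ t)⁻¹ * M.W = 0) : M.riskAversion t x = 0 := by
  rw [riskAversion, h]
  simp

omit mΩ in
lemma feedback_of_pos (K : Funds n) (h : 0 < x - (M.ρ t)⁻¹ * M.W) :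
    M.feedback K t x = (x - (M.ρ t)⁻¹ * M.W) • K.p t := by
  rw [feedback, if_pos (sub_pos.1 h).le]

omit mΩ in
lemma feedback_of_neg (K : Funds n) (h : x - (M.ρ t)⁻¹ * M.W < 0) :
    M.feedback K t x = (x - (M.ρ t)⁻¹ * M.W) • K.m t := by
  rw [feedback, if_neg (not_le.2 (sub_neg.1 h))]

omit mΩ in
lemma feedback_of_eq (K : Funds n) (h : x - (M.ρ t)⁻¹ * M.W = 0) : M.feedback K t x = 0 := by
  rw [feedback, h]
  simp

omit mΩ in
lemma inv_smul_mem_neg_cone {v : Fin n → ℝ} (hv : v ∈ M.cone t) {l : ℝ} (hl : l < 0) :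
    l⁻¹ • v ∈ -M.cone t := by
  rw [Set.mem_neg, ← neg_smul]
  exact smul_mem_cone hv (neg_nonneg.2 (inv_nonpos.2 hl.le))

namespace Standing

lemma nextCost_feedback_le (h : M.Standing μ) (ht : t < M.T) (hq : q.Regular (M.ρ (t + 1)))
    {K : Funds n} (hp : M.IsArgminPlus μ t q (K.p t)) (hm : M.IsArgminMinus μ t q (K.m t))
    {v : Fin n → ℝ} (hv : v ∈ M.cone t) (x : ℝ) :
    M.nextCost μ t q (M.riskAversion t x) (x - (M.ρ t)⁻¹ * M.W) (M.feedback K t x)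
      ≤ M.nextCost μ t q (M.riskAversion t x) (x - (M.ρ t)⁻¹ * M.W) v := by
  have hP := h.memLp_P ht
  rcases lt_trichotomy (x - (M.ρ t)⁻¹ * M.W) 0 with hx | hx | hx
  · rw [nextCost_of_neg hP hx, nextCost_of_neg hP hx, feedback_of_neg K hx, inv_smul_smul₀ hx.ne]
    exact mul_le_mul_of_nonneg_left (hm.2 (inv_smul_mem_neg_cone hv hx)) (sq_nonneg _)
  · rw [riskAversion_of_eq hx, feedback_of_eq K hx, hx, nextCost_zero_zero]
    rcases eq_or_ne v 0 with rfl | hv0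
    · rw [nextCost_zero_zero]
    · exact (nextCost_zero_pos hP (h.meas t ht) (h.cont t ht) hq hv0 0).le
  · rw [nextCost_of_pos hP hx, nextCost_of_pos hP hx, feedback_of_pos K hx, inv_smul_smul₀ hx.ne']
    exact mul_le_mul_of_nonneg_left (hp.2 (smul_mem_cone hv (inv_nonneg.2 hx.le))) (sq_nonneg _)

/-- Away from the target, rescaling `v` gives another minimizer of `F^±`. At the target, uniqueness
comes from strict positivity of the variance instead. -/
lemma eq_feedback_of_nextCost_le (h : M.Standing μ) (ht : t < M.T)
    (hq : q.Regular (M.ρ (t + 1)))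
    {K : Funds n} (hp : M.IsArgminPlus μ t q (K.p t)) (hm : M.IsArgminMinus μ t q (K.m t))
    (hpu : ∀ k, M.IsArgminPlus μ t q k → k = K.p t)
    (hmu : ∀ k, M.IsArgminMinus μ t q k → k = K.m t) {v : Fin n → ℝ} (hv : v ∈ M.cone t)
    (hle : M.nextCost μ t q (M.riskAversion t x) (x - (M.ρ t)⁻¹ * M.W) v
      ≤ M.nextCost μ t q (M.riskAversion t x) (x - (M.ρ t)⁻¹ * M.W) (M.feedback K t x)) :
    v = M.feedback K t x := by
  have hP := h.memLp_P ht
  rcases lt_trichotomy (x - (M.ρ t)⁻¹ * M.W) 0 with hx | hx | hx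
  · rw [nextCost_of_neg hP hx, nextCost_of_neg hP hx, feedback_of_neg K hx, inv_smul_smul₀ hx.ne]
      at hle
    have hle' := le_of_mul_le_mul_left hle (sq_pos_of_neg hx)
    rw [feedback_of_neg K hx, ← hmu _ ⟨inv_smul_mem_neg_cone hv hx, fun w hw =>
      hle'.trans (hm.2 hw)⟩, smul_inv_smul₀ hx.ne]
  · rw [riskAversion_of_eq hx, feedback_of_eq K hx, hx, nextCost_zero_zero] at hle
    rw [feedback_of_eq K hx]
    by_contra hv0
    exact hle.not_gt (nextCost_zero_pos hP (h.meas t ht) (h.cont t ht) hq hv0 0)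
  · rw [nextCost_of_pos hP hx, nextCost_of_pos hP hx, feedback_of_pos K hx, inv_smul_smul₀ hx.ne']
      at hle
    have hle' := le_of_mul_le_mul_left hle (sq_pos_of_pos hx)
    rw [feedback_of_pos K hx, ← hpu _ ⟨smul_mem_cone hv (inv_nonneg.2 hx.le), fun w hw =>
      hle'.trans (hp.2 hw)⟩, smul_inv_smul₀ hx.ne']

lemma isTimeConsistent_feedback (h : M.Standing μ) {K : Funds n} (hK : M.OptimalFrom μ 0 K) :
    M.IsTimeConsistent μ (M.feedback K) := by
  refine ⟨fun x0 => h.admissible_of_eq_feedback hK (r := 0) (fun j hj => absurd hj (by omega))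
    fun _ _ _ => rfl, fun t ht x0 u hu huK => ?_⟩
  -- Wealth up to time `t` depends only on earlier decisions, so both objectives are compared at the
  -- same `X_t`.
  have hw : ∀ j ≤ t, M.wealth x0 (Function.update u t (M.feedback K t)) j = M.wealth x0 u j :=
    fun j hj => wealth_congr fun i hi => Function.update_of_ne (by omega) _ _
  have hup : ∀ j, t < j → j < M.T → Function.update u t (M.feedback K t) j = M.feedback K j :=
    fun j hj hT => by rw [Function.update_of_ne (by omega), huK j hj hT]
  have hadm : M.Admissible μ x0 (Function.update u t (M.feedback K t)) := by
    refine h.admissible_of_eq_feedback hK (r := t) (fun j hj hT => ?_) fun j hj hT => ?_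
    · rw [hw j hj.le, Function.update_of_ne hj.ne]
      exact hu j hT
    · rcases hj.eq_or_lt with rfl | hlt
      · rw [Function.update_self]
      · exact hup j hlt hT
  refine ⟨hadm, ?_⟩
  obtain ⟨hp, hm⟩ := hK t t.zero_le ht
  filter_upwards [h.objective_eq hadm K ht hup, h.objective_eq hu K ht huK] with ω h1 h2
  rw [h1, h2, hw t le_rfl, Function.update_self]
  exact sub_le_sub_right (h.nextCost_feedback_le ht (h.regular K _) hp hm ((hu t ht).2.1 _) _) _

omit mΩ [IsProbabilityMeasure μ] in
/-- Without risky investment, every wealth level can be reached with certainty. -/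
lemma exists_wealth_eq (hs : ∀ t < M.T, 1 < M.s t) (ht : t ≤ M.T) (x : ℝ) :
    ∃ x0 : ℝ, ∀ u : ℕ → ℝ → (Fin n → ℝ), (∀ j < t, u j = 0) →
      ∀ ω, M.wealth x0 u t ω = x := by
  induction t generalizing x with
  | zero => exact ⟨x, fun _ _ _ => rfl⟩
  | succ t ih =>
    obtain ⟨x0, hx0⟩ := ih (by omega) (x / M.s t)
    refine ⟨x0, fun u hu ω => ?_⟩
    have hst : M.s t ≠ 0 := by linarith [hs t ht]
    simp only [wealth, hx0 u (fun j hj => hu j (by omega)) ω, hu t t.lt_succ_self, Pi.zero_apply,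
      dotProduct_zero, add_zero]
    field_simp

/-- A time consistent policy is the feedback policy if the minimizers are unique. -/
lemma eq_feedback_of_isTimeConsistent (h : M.Standing μ) {K : Funds n}
    (hK : M.OptimalFrom μ 0 K)
    (hpu : ∀ t < M.T, ∀ k, M.IsArgminPlus μ t (M.params μ K (t + 1)) k → k = K.p t)
    (hmu : ∀ t < M.T, ∀ k, M.IsArgminMinus μ t (M.params μ K (t + 1)) k → k = K.m t)
    {π : ℕ → ℝ → (Fin n → ℝ)} (hπ : M.IsTimeConsistent μ π) (t : ℕ) (ht : t < M.T) :
    π t = M.feedback K t := by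
  have hlater : ∀ j, t < j → j < M.T → π j = M.feedback K j := fun j hj hT =>
    eq_feedback_of_isTimeConsistent h hK hpu hmu hπ j hT
  funext x
  obtain ⟨hp, hm⟩ := hK t t.zero_le ht
  obtain ⟨x0, hx0⟩ := exists_wealth_eq (M := M) h.one_lt_s ht.le x
  -- The competitor holds no risky assets before `t`, so that `X_t = x` surely, and uses the
  -- candidate feedback at `t`; replacing that decision by `π t` can then be no worse.
  let u : ℕ → ℝ → (Fin n → ℝ) := fun j => if j < t then 0 else if j = t then M.feedback K t else π j
  have hu0 : ∀ j < t, u j = 0 := fun j hj => if_pos hj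
  have hut : u t = M.feedback K t := by simp [u]
  have huπ : ∀ j, t < j → j < M.T → u j = π j := fun j hj _ => by
    simp [u, hj.not_gt, hj.ne']
  have huK : ∀ j, t < j → j < M.T → u j = M.feedback K j := fun j hj hT =>
    (huπ j hj hT).trans (hlater j hj hT)
  have hadm : M.Admissible μ x0 u := by
    refine h.admissible_of_eq_feedback hK (r := t) (fun j hj _ => ?_) fun j hj hT => ?_
    · rw [hu0 j hj]
      exact ⟨measurable_const, fun x => zero_mem_cone, memLp_const 0⟩
    · rcases hj.eq_or_lt with rfl | hlt
      · exact hut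
      · exact huK j hlt hT
  obtain ⟨hadm', hle⟩ := hπ.2 t ht x0 u hadm huπ
  have hupK : ∀ j, t < j → j < M.T → Function.update u t (π t) j = M.feedback K j :=
    fun j hj hT => by rw [Function.update_of_ne (by omega), huK j hj hT]
  have hup0 : ∀ j < t, Function.update u t (π t) j = 0 := fun j hj => by
    rw [Function.update_of_ne hj.ne, hu0 j hj]
  -- Since `X_t` is deterministic, a single `ω` from the almost sure event gives the inequality at
  -- `x`.
  obtain ⟨ω, e1, e2, e3⟩ := (hle.and ((h.objective_eq hadm' K ht hupK).and
    (h.objective_eq hadm K ht huK))).exists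
  rw [e2, e3] at e1
  beta_reduce at e1
  rw [hx0 _ hup0, hx0 _ hu0, Function.update_self, hut] at e1
  exact h.eq_feedback_of_nextCost_le ht (h.regular K _) hp hm (hpu t ht) (hmu t ht)
    ((hπ.1 x0 t ht).2.1 x) ((sub_le_sub_iff_right _).1 e1)
termination_by M.T - t

end Standing

end ConeMarket

end

theorem theorem2 {Ω : Type*} [MeasurableSpace Ω] (μ : Measure Ω) [IsProbabilityMeasure μ]
    {n m : ℕ} (M : ConeMarket Ω n m)
    (hs : ∀ t < M.T, 1 < M.s t)
    (hmeas : ∀ t < M.T, Measurable (M.e t))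
    (hindep : iIndepFun (fun t : Fin M.T => M.e t) μ)
    (hL2 : ∀ t < M.T, MemLp (M.e t) 2 μ)
    -- the rates of return are continuous random vectors: they have a density
    (hcont : ∀ t < M.T, μ.map (M.e t) ≪ volume)
    (hcov : ∀ t < M.T, (Matrix.of fun i j : Fin n =>
      cov[fun ω => M.e t ω i, fun ω => M.e t ω j; μ]).PosDef) :
    -- the minima defining the investment funds are attained, at each stage of the recursion
    (∀ t < M.T, ∀ K : Funds n, M.OptimalFrom μ (t + 1) K →
      (∃ k, M.IsArgminPlus μ t (M.params μ K (t + 1)) k) ∧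
      (∃ k, M.IsArgminMinus μ t (M.params μ K (t + 1)) k)) ∧
    (∃ K : Funds n, M.OptimalFrom μ 0 K) ∧
    -- the resulting piecewise linear feedback policy is time consistent
    (∀ K : Funds n, M.OptimalFrom μ 0 K → M.IsTimeConsistent μ (M.feedback K)) ∧
    -- and it is the only time consistent policy when the minimizers are unique
    (∀ K : Funds n, M.OptimalFrom μ 0 K →
      (∀ t < M.T, ∀ k, M.IsArgminPlus μ t (M.params μ K (t + 1)) k → k = K.p t) →
      (∀ t < M.T, ∀ k, M.IsArgminMinus μ t (M.params μ K (t + 1)) k → k = K.m t) →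
      ∀ π : ℕ → ℝ → (Fin n → ℝ), M.IsTimeConsistent μ π →
        ∀ t < M.T, ∀ x, π t x = M.feedback K t x) := by
  have h : M.Standing μ := ⟨hs, hmeas, hindep, hL2, hcont⟩
  have hmin : ∀ t < M.T, ∀ K : Funds n,
      (∃ k, M.IsArgminPlus μ t (M.params μ K (t + 1)) k) ∧
      (∃ k, M.IsArgminMinus μ t (M.params μ K (t + 1)) k) := fun t ht K =>
    ⟨ConeMarket.exists_isArgminPlus (h.memLp_P ht) (hmeas t ht) (hcont t ht) (h.regular K _),
      ConeMarket.exists_isArgminMinus (h.memLp_P ht) (hmeas t ht) (hcont t ht) (h.regular K _)⟩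
  refine ⟨fun t ht K _ => hmin t ht K, ConeMarket.exists_optimalFrom hmin 0,
    fun K hK => h.isTimeConsistent_feedback hK, fun K hK hp hm π hπ t ht x => ?_⟩
  rw [h.eq_feedback_of_isTimeConsistent hK hp hm hπ t ht]
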